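/- **Setting.** Let $\Lambda$ be a finite set of labels with arities $\mathrm{ar}:\Lambda\to\mathbb N$. A graph $G$ has finite sets $V_G,E_G$ of nodes and edges, a connection map $c_G:E_G\to V_G^*$ and a labelling $l_G:E_G\to\Lambda$ with $|c_G(e)|=\mathrm{ar}(l_G(e))$. A morphism $\phi:G\rightharpoonup G'$ is a pair of partial functions on nodes and edges that preserves labels and connections where it is defined on edges, and that is defined on all nodes incident to an edge on which it is defined. Pushouts are taken in the category of graphs and (partial) morphisms. A subgraph morphism is a partial, injective and surjective morphism; $G_1\sqsubseteq G_2$ means that there is a subgraph morphism $G_2\rightharpoonup G_1$; $\uparrow\!S=\{G'\mid\exists G\in S:\ G\sqsubseteq G'\}$. For $k\in\mathbb N$ let $\mathcal G_k$ be the class of graphs in which every undirected path (without repeated nodes or edges) has length at most $k$. **Rules.** A universally quantified rule $\rho=(r,U)$ is a morphism $r:L\rightharpoonup R$ with a finite set $U$ of pairs $u=(p_u,q_u)$, where $p_u:L\to L_u$ is total and injective and $q_u:L_u\rightharpoonup R_u$ is such that $q_u(p_u(x))$ is defined and has exactly one preimage in $L_u$ for every node or edge $x$ of $L$. The quantified nodes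 of $u$ are the nodes $v$ of $L$ such that some edge incident to $p_u(v)$ has no preimage in $L$; there must be at least one for each $u$; the quantified nodes of $\rho$ are those of all $u\in U$. Instantiations of $\rho$: $(\mathrm{id}_L,r)$ is one, of length $0$; if $(\pi:L\to\overline L,\ \gamma:\overline L\rightharpoonup\overline R)$ is one, of length $n$, and $u\in U$, let $\overline L_u$ be a pushout of $\pi,p_u$ with $p_u':\overline L\to\overline L_u$, let $\overline R_u$ be a pushout of $\gamma\circ\pi$, $q_u\circ p_u$, and let $\eta:\overline L_u\rightharpoonup\overline R_u$ be the mediating morphism; then $(p_u'\circ\pi,\eta)$ is one, of length $n+1$. A total injective $m:\overline L\to G$ satisfies the application condition if every edge of $G$ incident to $m(\pi(x))$, with $x$ a quantified node of $\rho$, has a preimage in $\overline L$. Fix a finite set $\mathcal R$ of such rules. Write $G\Rightarrow H$ if, for some instantiation $(\pi,\gamma)$ of a rule in $\mathcal R$ and some total injective $m:\overline L\to G$ satisfying the application condition, $H$ is the pushout of $m$ and $\gamma$. Put $\mathrm{Pred}_{\mathcal G_k}(S)=\{G'\in\mathcal G_k\mid\exists G\in S:\ G'\Rightarrow G\}$.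 **Backward step.** The backward application of an instantiation $(\pi,\gamma)$ of $\rho$ to $G$ computes all graphs $G'$ obtained as follows: choose a subgraph morphism $\mu:\overline R\rightharpoonup R'$ and a total injective $m':R'\to G$; consider all pushout complements $(G',\ m:\overline L\to G')$ of $\mu\circ\gamma$ and $m'$ with $m$ total and injective and $G'\in\mathcal G_k$; keep those for which $G'$ is $\sqsubseteq$-minimal among them and $m$ satisfies the application condition. A number $N$ is an *instantiation bound* for $\rho$ and $G$ if for every graph $G'$ computed by the backward application to $G$ of an instantiation of $\rho$ of any length there is a graph $G''\sqsubseteq G'$ computed by the backward application to $G$ of an instantiation of $\rho$ of length at most $N$. Given numbers $I_\rho(G)$ for $\rho\in\mathcal R$, let $\mathrm{predBasis}_k(G)$ be the set of all graphs (up to isomorphism) computed by the backward application to $G$ of instantiations of rules $\rho\in\mathcal R$ of length at most $I_\rho(G)$. **Lemma.** Let $k\in\mathbb N$ and let $G$ be a graph. 1. For every $\rho\in\mathcal R$, the number $|V_G|+|E_G|$ is an instantiation bound for $\rho$ and $G$. 2. If $I_\rho(G)$ is an instantiation bound for $\rho$ and $G$, for every $\rho\in\mathcal R$ (for instance $I_\rho(G)=|V_G|+|E_G|$),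 then $$\uparrow\!\mathrm{predBasis}_k(G)\ \supseteq\ \uparrow\!\mathrm{Pred}_{\mathcal G_k}(\uparrow\!\{G\}).$$ -/

import Mathlib

open CategoryTheory

universe u v

/-- A (finite) `Λ`-hypergraph: every edge `e` is connected to a sequence `c e` of nodes whose length
is the arity of the label of `e`. -/
structure HGraph (Λ : Type v) (ar : Λ → ℕ) where
  V : Type u
  E : Type u
  finV : Finite V
  finE : Finite E
  c : E → List V
  l : E → Λ
  length_c : ∀ e, (c e).length = ar (l e)

namespace HGraph

variable {Λ : Type v} {ar : Λ → ℕ}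

/-- The edge `e` is incident to the node `x`. -/
def Incident (G : HGraph.{u} Λ ar) (e : G.E) (x : G.V) : Prop := x ∈ G.c e

/-- The number of nodes and edges. -/
noncomputable def size (G : HGraph.{u} Λ ar) : ℕ := Nat.card G.V + Nat.card G.E

/-- Partial hypergraph morphisms: partial functions on nodes and on edges, `none` meaning
"undefined". The field `map_c` also says that all nodes incident to an edge in the domain
of `fE` are in the domain of `fV`. -/
@[ext]
structure PMor (G H : HGraph.{u} Λ ar) where
  fV : G.V → Option H.V
  fE : G.E → Option H.E
  map_l : ∀ e e', fE e = some e' → H.l e' = G.l e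
  map_c : ∀ e e', fE e = some e' → (G.c e).map fV = (H.c e').map some

/-- The identity morphism. -/
def PMor.id (G : HGraph.{u} Λ ar) : PMor G G where
  fV := some
  fE := some
  map_l := by rintro e e' h; cases h; rfl
  map_c := by rintro e e' h; cases h; rfl

/-- Composition (first `f`, then `g`): defined where `f` is and where `g` is defined on the
value. -/
def PMor.comp {G H K : HGraph.{u} Λ ar} (f : PMor G H) (g : PMor H K) : PMor G K where
  fV := fun x => (f.fV x).bind g.fV
  fE := fun e => (f.fE e).bind g.fE
  map_l := by
    intro e e'' h
    obtain ⟨e', h1, h2⟩ := Option.bind_eq_some_iff.1 h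
    rw [g.map_l _ _ h2, f.map_l _ _ h1]
  map_c := by
    intro e e'' h
    obtain ⟨e', h1, h2⟩ := Option.bind_eq_some_iff.1 h
    have h3 := congrArg (List.map (fun o : Option H.V => o.bind g.fV)) (f.map_c _ _ h1)
    rw [List.map_map, List.map_map] at h3
    have h4 := g.map_c _ _ h2
    exact h3.trans h4

/-- The category of hypergraphs and partial morphisms. -/
instance : Category (HGraph.{u} Λ ar) where
  Hom := PMor
  id := PMor.id
  comp := PMor.comp
  id_comp := by intros; rfl
  comp_id := by
    intro X Y f
    apply PMor.ext
    · funext x; exact Option.bind_fun_some (f.fV x)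
    · funext x; exact Option.bind_fun_some (f.fE x)
  assoc := by
    intro W X Y Z f g h
    apply PMor.ext
    · funext x; exact Option.bind_assoc (f.fV x) g.fV h.fV
    · funext x; exact Option.bind_assoc (f.fE x) g.fE h.fE

/-- The node part of a morphism. -/
def nodeMap {G H : HGraph.{u} Λ ar} (f : G ⟶ H) : G.V → Option H.V := PMor.fV f

/-- The edge part of a morphism. -/
def edgeMap {G H : HGraph.{u} Λ ar} (f : G ⟶ H) : G.E → Option H.E := PMor.fE f

/-- The morphism is defined everywhere. -/
def IsTotal {G H : HGraph.{u} Λ ar} (f : G ⟶ H) : Prop :=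
  (∀ x, ∃ y, nodeMap f x = some y) ∧ (∀ e, ∃ e', edgeMap f e = some e')

/-- The (possibly partial) morphism is injective where it is defined. -/
def IsInj {G H : HGraph.{u} Λ ar} (f : G ⟶ H) : Prop :=
  (∀ x x' y, nodeMap f x = some y → nodeMap f x' = some y → x = x') ∧
    (∀ e e' d, edgeMap f e = some d → edgeMap f e' = some d → e = e')

/-- The (possibly partial) morphism is surjective. -/
def IsSurj {G H : HGraph.{u} Λ ar} (f : G ⟶ H) : Prop :=
  (∀ y, ∃ x, nodeMap f x = some y) ∧ (∀ d, ∃ e, edgeMap f e = some d)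

/-- Subgraph morphisms: partial, injective and surjective. -/
def IsSubgraphMor {G H : HGraph.{u} Λ ar} (μ : G ⟶ H) : Prop := IsInj μ ∧ IsSurj μ

/-- The subgraph ordering: `G₁` is a subgraph of `G₂`. -/
def SubOrder (G₁ G₂ : HGraph.{u} Λ ar) : Prop := ∃ μ : G₂ ⟶ G₁, IsSubgraphMor μ

/-- The upward closure of a set of graphs with respect to the subgraph ordering. -/
def upClosure (S : Set (HGraph.{u} Λ ar)) : Set (HGraph.{u} Λ ar) :=
  {G' | ∃ G ∈ S, SubOrder G G'}

/-- `x 0, e 0, x 1, …, e (n-1), x n` is an undirected path of length `n`; no node and no edge is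
repeated. -/
def IsUndirectedPath (G : HGraph.{u} Λ ar) (n : ℕ) (x : Fin (n + 1) → G.V) (e : Fin n → G.E) :
    Prop :=
  Function.Injective x ∧ Function.Injective e ∧
    ∀ i : Fin n, G.Incident (e i) (x i.castSucc) ∧ G.Incident (e i) (x i.succ)

/-- The class of graphs in which every undirected path has length at most `k`. -/
def boundedPath (k : ℕ) : Set (HGraph.{u} Λ ar) :=
  {G | ∀ n x e, G.IsUndirectedPath n x e → n ≤ k}

/-- A universal quantification of a rule with left-hand side `L`: a total injective `p : L ⟶ Lu` and
a partial `q : Lu ⟶ Ru` such that, for each node or edge `x` of `L`, `q (p x)` is defined and `p x`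
is its only preimage under `q`; moreover some node of `L` is quantified, i.e. its image is
incident to an edge of `Lu` that has no preimage in `L`. -/
structure UQuant (L : HGraph.{u} Λ ar) where
  Lu : HGraph.{u} Λ ar
  Ru : HGraph.{u} Λ ar
  p : L ⟶ Lu
  q : Lu ⟶ Ru
  p_total : IsTotal p
  p_inj : IsInj p
  node_cond : ∀ x : L.V, ∃ y, nodeMap (p ≫ q) x = some y ∧
    ∀ z, nodeMap q z = some y → nodeMap p x = some z
  edge_cond : ∀ e : L.E, ∃ d, edgeMap (p ≫ q) e = some d ∧
    ∀ z, edgeMap q z = some d → edgeMap p e = some z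
  qNodes_nonempty : ∃ (x : L.V) (y : Lu.V) (e : Lu.E),
    nodeMap p x = some y ∧ Lu.Incident e y ∧ ∀ d : L.E, edgeMap p d ≠ some e

/-- The quantified nodes of a universal quantification. -/
def UQuant.qNodes {L : HGraph.{u} Λ ar} (w : UQuant L) : Set L.V :=
  {x | ∃ (y : w.Lu.V) (e : w.Lu.E),
    nodeMap w.p x = some y ∧ w.Lu.Incident e y ∧ ∀ d : L.E, edgeMap w.p d ≠ some e}

/-- Universally quantified rules `(r, U)`. -/
structure UQRule (Λ : Type v) (ar : Λ → ℕ) where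
  L : HGraph.{u} Λ ar
  R : HGraph.{u} Λ ar
  r : L ⟶ R
  U : Set (UQuant L)
  U_finite : U.Finite

/-- The quantified nodes of a rule. -/
def UQRule.qNodes (ρ : UQRule.{u} Λ ar) : Set ρ.L.V := {x | ∃ w ∈ ρ.U, x ∈ w.qNodes}

/-- A pair of morphisms `π : L ⟶ Lbar`, `γ : Lbar ⟶ Rbar`. -/
structure InstPair (L : HGraph.{u} Λ ar) where
  Lbar : HGraph.{u} Λ ar
  Rbar : HGraph.{u} Λ ar
  π : L ⟶ Lbar
  γ : Lbar ⟶ Rbar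

/-- `ι'` extends `ι = (π, γ)` by the universal quantification `w = (p, q)`: with `Lbar'` a pushout
of `π`, `p` and `Rbar'` a pushout of `π ≫ γ`, `p ≫ q`, it consists of the morphism `L ⟶ Lbar'` and
of the mediating morphism `Lbar' ⟶ Rbar'`. -/
def InstPair.IsExtension {L : HGraph.{u} Λ ar} (ι : InstPair L) (w : UQuant L)
    (ι' : InstPair L) : Prop :=
  ∃ (p' : ι.Lbar ⟶ ι'.Lbar) (π' : w.Lu ⟶ ι'.Lbar) (p'' : ι.Rbar ⟶ ι'.Rbar)
    (π'' : w.Ru ⟶ ι'.Rbar),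
    IsPushout ι.π w.p p' π' ∧ IsPushout (ι.π ≫ ι.γ) (w.p ≫ w.q) p'' π'' ∧
      ι'.π = ι.π ≫ p' ∧ p' ≫ ι'.γ = ι.γ ≫ p'' ∧ π' ≫ ι'.γ = w.q ≫ π''

/-- `ρ.IsInst n ι`: `ι` is an instantiation of `ρ` of length `n`. -/
inductive UQRule.IsInst (ρ : UQRule.{u} Λ ar) : ℕ → InstPair ρ.L → Prop
  | base : UQRule.IsInst ρ 0 ⟨ρ.L, ρ.R, 𝟙 ρ.L, ρ.r⟩
  | step {n : ℕ} {ι ι' : InstPair ρ.L} {w : UQuant ρ.L} :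
      UQRule.IsInst ρ n ι → w ∈ ρ.U → ι.IsExtension w ι' → UQRule.IsInst ρ (n + 1) ι'

/-- The application condition for a match `m : Lbar ⟶ G` of the instantiation `ι`: every edge
incident to the image of a quantified node has a preimage in `Lbar`. -/
def UQRule.AppCond (ρ : UQRule.{u} Λ ar) (ι : InstPair ρ.L) {G : HGraph.{u} Λ ar}
    (m : ι.Lbar ⟶ G) : Prop :=
  ∀ x ∈ ρ.qNodes, ∀ y : G.V, nodeMap (ι.π ≫ m) x = some y →
    ∀ e : G.E, G.Incident e y → ∃ d : ι.Lbar.E, edgeMap m d = some e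

/-- `G` can be rewritten to `H` by one application of the rule `ρ`. -/
def UQRule.Rewrites (ρ : UQRule.{u} Λ ar) (G H : HGraph.{u} Λ ar) : Prop :=
  ∃ (n : ℕ) (ι : InstPair ρ.L) (m : ι.Lbar ⟶ G), ρ.IsInst n ι ∧ IsTotal m ∧ IsInj m ∧
    ρ.AppCond ι m ∧ ∃ (γ' : G ⟶ H) (n' : ι.Rbar ⟶ H), IsPushout m ι.γ γ' n'

/-- A graph transformation system with universally quantified rules: a finite set of rules. -/
structure UGTS (Λ : Type v) (ar : Λ → ℕ) where
  rules : Set (UQRule.{u} Λ ar)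
  rules_finite : rules.Finite

/-- One rewriting step of the system. -/
def UGTS.Step (𝓡 : UGTS.{u} Λ ar) (G H : HGraph.{u} Λ ar) : Prop :=
  ∃ ρ ∈ 𝓡.rules, ρ.Rewrites G H

/-- The predecessors of a set of graphs. -/
def UGTS.pred (𝓡 : UGTS.{u} Λ ar) (S : Set (HGraph.{u} Λ ar)) : Set (HGraph.{u} Λ ar) :=
  {G' | ∃ G ∈ S, 𝓡.Step G' G}

/-- The predecessors of `S` that lie in the class `C`. -/
def UGTS.predIn (𝓡 : UGTS.{u} Λ ar) (C S : Set (HGraph.{u} Λ ar)) : Set (HGraph.{u} Λ ar) :=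
  𝓡.pred S ∩ C

/-- `G'` with `m : L ⟶ G'` is a pushout complement of `φ : L ⟶ R` and `m' : R ⟶ G`. -/
def IsPushoutComplement {L R G G' : HGraph.{u} Λ ar} (φ : L ⟶ R) (m' : R ⟶ G) (m : L ⟶ G') :
    Prop :=
  ∃ φ' : G' ⟶ G, IsPushout φ m m' φ'

/-- The objects `G' ∈ boundedPath k` of pushout complements of `φ` and `m'` whose match
`m : L ⟶ G'` is total and injective. -/
def complements (k : ℕ) {L R G : HGraph.{u} Λ ar} (φ : L ⟶ R) (m' : R ⟶ G) :
    Set (HGraph.{u} Λ ar) :=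
  {G' | G' ∈ boundedPath k ∧
    ∃ m : L ⟶ G', IsTotal m ∧ IsInj m ∧ IsPushoutComplement φ m' m}

/-- The graphs computed by the backward application of one instantiation `ι` of `ρ` to `G`: those
`G'` for which there are a subgraph morphism `μ : Rbar ⟶ R'`, a total injective co-match
`m' : R' ⟶ G` and a total injective `m : Lbar ⟶ G'` satisfying the application condition, such that
`G'`, `m` is a pushout complement of `ι.γ ≫ μ` and `m'`, and `G'` is minimal (in the subgraph
ordering) among such complements in `boundedPath k`. -/
def UQRule.backInst (k : ℕ) (ρ : UQRule.{u} Λ ar) (ι : InstPair ρ.L) (G : HGraph.{u} Λ ar) :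
    Set (HGraph.{u} Λ ar) :=
  {G' | ∃ (R' : HGraph.{u} Λ ar) (μ : ι.Rbar ⟶ R') (m' : R' ⟶ G) (m : ι.Lbar ⟶ G'),
    IsSubgraphMor μ ∧ IsTotal m' ∧ IsInj m' ∧
      G' ∈ boundedPath k ∧ IsTotal m ∧ IsInj m ∧ IsPushoutComplement (ι.γ ≫ μ) m' m ∧
      (∀ H ∈ complements k (ι.γ ≫ μ) m', SubOrder H G' → SubOrder G' H) ∧
      ρ.AppCond ι m}

/-- The graphs computed backwards from `G` with instantiations of `ρ` of length at most `N`. -/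
def UQRule.backStep (k : ℕ) (ρ : UQRule.{u} Λ ar) (N : ℕ) (G : HGraph.{u} Λ ar) :
    Set (HGraph.{u} Λ ar) :=
  {G' | ∃ (n : ℕ) (ι : InstPair ρ.L), n ≤ N ∧ ρ.IsInst n ι ∧ G' ∈ ρ.backInst k ι G}

/-- `N` is an upper bound on the length of the instantiations of `ρ` that are necessary to compute
a backward step from `G`: each graph computed with an instantiation of any length is represented by
one that is computed with an instantiation of length at most `N`. -/
def UQRule.IsInstBound (k : ℕ) (ρ : UQRule.{u} Λ ar) (G : HGraph.{u} Λ ar) (N : ℕ) : Prop :=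
  ∀ (n : ℕ) (ι : InstPair ρ.L), ρ.IsInst n ι → ∀ G' ∈ ρ.backInst k ι G,
    ∃ G'' ∈ ρ.backStep k N G, SubOrder G'' G'

/-- The result of the backward step from `G` for all rules of the system, with instantiations
of a rule `ρ` computed up to the length `I ρ G`. -/
def UGTS.predBasis (𝓡 : UGTS.{u} Λ ar) (k : ℕ) (I : UQRule.{u} Λ ar → HGraph.{u} Λ ar → ℕ)
    (G : HGraph.{u} Λ ar) : Set (HGraph.{u} Λ ar) :=
  {G' | ∃ ρ ∈ 𝓡.rules, G' ∈ ρ.backStep k (I ρ G) G}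

end HGraph

/-! A pushout along a total injective match `m` is explicit even for partial rule morphisms: it is
the right-hand side together with the surviving part of the host graph outside the match. A node
outside the match always survives, an edge outside it exactly when all its nodes do (`IsGluing`).
Hence every complement contains the match plus one element for each element of the result outside
the co-match. A complement in which everything outside the match survives is thus of least size, and
therefore minimal.

`exists_sub_complement` produces such a complement: from a rewritten graph keep a chosen part of the
match and, outside the match, what survives. This is a subgraph, provided that all surviving nodes
of the match lie in the chosen part. The application condition and the path bound are inherited.

For a step `G' ⇒ H` with `G ⊑ H`, keep the whole match and let `R'` be the part of the right-hand
side that survives in `G`. This gives a graph below `G'` computed backwards from `G`, by an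
instantiation of unknown length.

To bound the length, note that only the elements of `Rbar` in the domain of `μ` are visible in `G`,
and there are at most `|V_G| + |E_G|` of them. An extension step whose new right-hand elements are
all invisible can be dropped; each remaining step contributes a visible element
(`UQRule.exists_short_inst`). Restricting to the shortened left-hand side gives a smaller complement
over the same `R'` and `m'`. Transitivity of `⊑` then gives the inclusion. -/

namespace HGraph

/-! ### Gluing sets along partial functions -/

/-- The square of partial functions `f : A ⇀ C`, `m : A ⇀ B`, `n : C ⇀ D`, `g : B ⇀ D` exhibits `D`
as the disjoint union of `C` and of the part of `B` outside the range of `m` on which `g` is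
defined. -/
structure GlueSet {A B C D : Type*} (f : A → Option C) (m : A → Option B) (n : C → Option D)
    (g : B → Option D) : Prop where
  comm : ∀ a, (f a).bind n = (m a).bind g
  total : ∀ c, ∃ d, n c = some d
  inj : ∀ c c' d, n c = some d → n c' = some d → c = c'
  cover : ∀ d, (∃ c, n c = some d) ∨ ∃ b, (∀ a, m a ≠ some b) ∧ g b = some d
  off_inj : ∀ b b' d, (∀ a, m a ≠ some b) → (∀ a, m a ≠ some b') → g b = some d →
    g b' = some d → b = b'
  off_disj : ∀ b c d, (∀ a, m a ≠ some b) → g b = some d → n c ≠ some d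

namespace GlueSet

variable {A B C D X : Type*} {f : A → Option C} {m : A → Option B} {n : C → Option D}
  {g : B → Option D}

theorem exists_preimage (h : GlueSet f m n g) {b : B} {c : C} {d : D} (hb : g b = some d)
    (hc : n c = some d) : ∃ a, m a = some b ∧ f a = some c := by
  by_cases hm : ∃ a, m a = some b
  · obtain ⟨a, ha⟩ := hm
    have h1 := h.comm a
    rw [ha, Option.bind_some, hb] at h1
    obtain ⟨c', h2, h3⟩ := Option.bind_eq_some_iff.1 h1
    exact ⟨a, ha, by rw [h2, h.inj _ _ _ hc h3]⟩
  · push Not at hm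
    exact absurd hc (h.off_disj b c d hm hb)

open Classical in
/-- The partial function out of a glued set that is determined by its values on the two parts. -/
noncomputable def desc (n : C → Option D) (g : B → Option D) (x : C → Option X)
    (y : B → Option X) (d : D) : Option X :=
  if h : ∃ c, n c = some d then x h.choose
  else if h : ∃ b, g b = some d then y h.choose else none

theorem desc_left (h : GlueSet f m n g) (x : C → Option X) (y : B → Option X) (c : C) :
    (n c).bind (desc n g x y) = x c := by
  obtain ⟨d, hd⟩ := h.total c
  have h1 : ∃ c, n c = some d := ⟨c, hd⟩
  rw [hd, Option.bind_some, desc, dif_pos h1, h.inj _ _ _ h1.choose_spec hd]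

theorem desc_right_of_eq_some (h : GlueSet f m n g) {x : C → Option X} {y : B → Option X}
    (hxy : ∀ a, (f a).bind x = (m a).bind y) {b : B} {d : D} (hb : g b = some d) :
    desc n g x y d = y b := by
  by_cases hm : ∃ c, n c = some d
  · obtain ⟨c, hc⟩ := hm
    obtain ⟨a, ha, ha'⟩ := h.exists_preimage hb hc
    have h1 := hxy a
    have h2 := h.desc_left x y c
    rw [hc, Option.bind_some] at h2
    rw [ha, ha', Option.bind_some, Option.bind_some] at h1
    rw [h2, h1]
  · have hg : ∃ b, g b = some d := ⟨b, hb⟩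
    rw [desc, dif_neg hm, dif_pos hg]
    -- As `d` is not in `C`, all its preimages in `B` lie outside the range of `m`, where `g` is
    -- injective; so the chosen preimage is `b`.
    have key : ∀ b', g b' = some d → ∀ a, m a ≠ some b' := by
      intro b' hb' a ha
      have h1 := h.comm a
      rw [ha, Option.bind_some, hb'] at h1
      obtain ⟨c', h2, h3⟩ := Option.bind_eq_some_iff.1 h1
      exact hm ⟨c', h3⟩
    rw [h.off_inj _ _ _ (key _ hg.choose_spec) (key _ hb) hg.choose_spec hb]

theorem hom_ext (h : GlueSet f m n g) {k k' : D → Option X}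
    (h1 : ∀ c, (n c).bind k = (n c).bind k') (h2 : ∀ b, (g b).bind k = (g b).bind k') :
    k = k' := by
  funext d
  rcases h.cover d with ⟨c, hc⟩ | ⟨b, -, hb⟩
  · simpa [hc] using h1 c
  · simpa [hb] using h2 b

theorem exists_off (h : GlueSet f m n g) {d : D} (hd : ∀ c, n c ≠ some d) :
    ∃ b, (∀ a, m a ≠ some b) ∧ g b = some d :=
  (h.cover d).resolve_left (by rintro ⟨c, hc⟩; exact hd c hc)

theorem comp_bijective {D' : Type*} (h : GlueSet f m n g) {e : D → Option D'}
    (e_total : ∀ d, ∃ d', e d = some d') (e_inj : ∀ d d' x, e d = some x → e d' = some x → d = d')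
    (e_surj : ∀ d', ∃ d, e d = some d') :
    GlueSet f m (fun c => (n c).bind e) (fun b => (g b).bind e) where
  comm a := by
    have := congrArg (fun o => o.bind e) (h.comm a)
    simpa only [Option.bind_assoc] using this
  total c := by
    obtain ⟨d, hd⟩ := h.total c
    simpa [hd] using e_total d
  inj c c' d h1 h2 := by
    obtain ⟨x, hx, hx'⟩ := Option.bind_eq_some_iff.1 h1
    obtain ⟨y, hy, hy'⟩ := Option.bind_eq_some_iff.1 h2
    obtain rfl := e_inj _ _ _ hx' hy'
    exact h.inj _ _ _ hx hy
  cover d' := by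
    obtain ⟨d, hd⟩ := e_surj d'
    rcases h.cover d with ⟨c, hc⟩ | ⟨b, hb, hb'⟩
    · exact Or.inl ⟨c, by simp [hc, hd]⟩
    · exact Or.inr ⟨b, hb, by simp [hb', hd]⟩
  off_inj b b' d hb hb' h1 h2 := by
    obtain ⟨x, hx, hx'⟩ := Option.bind_eq_some_iff.1 h1
    obtain ⟨y, hy, hy'⟩ := Option.bind_eq_some_iff.1 h2
    obtain rfl := e_inj _ _ _ hx' hy'
    exact h.off_inj _ _ _ hb hb' hx hy
  off_disj b c d hb h1 h2 := by
    obtain ⟨x, hx, hx'⟩ := Option.bind_eq_some_iff.1 h1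
    obtain ⟨y, hy, hy'⟩ := Option.bind_eq_some_iff.1 h2
    obtain rfl := e_inj _ _ _ hx' hy'
    exact h.off_disj _ _ _ hb hx hy

/-- Among the sets `B` that complete `f` and `n` to a gluing along a total injective `m`, those
all of whose elements outside the range of `m` survive have the least number of elements. -/
theorem card_le {B' : Type*} [Finite B'] {m' : A → Option B'} {g' : B' → Option D}
    (h : GlueSet f m n g) (h' : GlueSet f m' n g')
    (m'_total : ∀ a, ∃ b, m' a = some b)
    (m'_inj : ∀ a a' b, m' a = some b → m' a' = some b → a = a')
    (hg : ∀ b, (∀ a, m a ≠ some b) → ∃ d, g b = some d) : Nat.card B ≤ Nat.card B' := by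
  -- Inject `B` into `B'`: elements of the match go through `A`, the others through their surviving
  -- image in `D`, which misses `C` and so has a preimage in `B'` outside the range of `m'`.
  have key : ∀ b, ∃ b', (∃ a, m a = some b ∧ m' a = some b') ∨ ((∀ a, m a ≠ some b) ∧
      (∀ a, m' a ≠ some b') ∧ ∃ d, g b = some d ∧ g' b' = some d) := by
    intro b
    by_cases hb : ∃ a, m a = some b
    · obtain ⟨a, ha⟩ := hb
      obtain ⟨b', hb'⟩ := m'_total a
      exact ⟨b', Or.inl ⟨a, ha, hb'⟩⟩
    · push Not at hb
      obtain ⟨d, hd⟩ := hg b hb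
      obtain ⟨b', h1, h2⟩ := h'.exists_off (fun c => h.off_disj b c d hb hd)
      exact ⟨b', Or.inr ⟨hb, h1, d, hd, h2⟩⟩
  choose s hs using key
  refine Nat.card_le_card_of_injective s fun x y hxy => ?_
  have hx := hs x
  have hy := hs y
  rw [← hxy] at hy
  rcases hx with ⟨a, h1, h2⟩ | ⟨h1, h2, d, h3, h4⟩ <;>
    rcases hy with ⟨a', h1', h2'⟩ | ⟨h1', h2', d', h3', h4'⟩
  · obtain rfl := m'_inj _ _ _ h2 h2'
    exact Option.some.inj (h1.symm.trans h1')
  · exact absurd h2 (h2' a)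
  · exact absurd h2' (h2 a')
  · obtain rfl := Option.some.inj (h4.symm.trans h4')
    exact h.off_inj _ _ _ h1 h1' h3 h3'

open Classical in
/-- The map from `B` to the gluing `C ⊕ {b // P b}`, where `P` selects the surviving elements
of `B` outside the range of `m`. -/
noncomputable def incr (f : A → Option C) (m : A → Option B) (P : B → Prop) (b : B) :
    Option (C ⊕ {b : B // (∀ a, m a ≠ some b) ∧ P b}) :=
  if h : ∃ a, m a = some b then (f h.choose).map Sum.inl
  else if h' : (∀ a, m a ≠ some b) ∧ P b then some (Sum.inr ⟨b, h'⟩) else none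

theorem incr_apply (m_inj : ∀ a a' b, m a = some b → m a' = some b → a = a') (P : B → Prop)
    {a : A} {b : B} (hab : m a = some b) : incr f m P b = (f a).map Sum.inl := by
  have h : ∃ a, m a = some b := ⟨a, hab⟩
  rw [incr, dif_pos h, m_inj _ _ _ h.choose_spec hab]

theorem incr_off (P : B → Prop) {b : B} (hb : ∀ a, m a ≠ some b) (hP : P b) :
    incr f m P b = some (Sum.inr ⟨b, hb, hP⟩) := by
  rw [incr, dif_neg (by push Not; exact hb), dif_pos ⟨hb, hP⟩]

theorem incr_off_eq_some {P : B → Prop} {b : B} (hb : ∀ a, m a ≠ some b) {d}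
    (h : incr f m P b = some d) : ∃ hP : P b, d = Sum.inr ⟨b, hb, hP⟩ := by
  rw [incr, dif_neg (by push Not; exact hb)] at h
  split_ifs at h with h'
  exact ⟨h'.2, (Option.some.inj h).symm⟩

theorem glueSet_incr (m_total : ∀ a, ∃ b, m a = some b)
    (m_inj : ∀ a a' b, m a = some b → m a' = some b → a = a') (P : B → Prop) :
    GlueSet f m (fun c => some (Sum.inl c)) (incr f m P) where
  comm a := by
    obtain ⟨b, hb⟩ := m_total a
    rw [hb, Option.bind_some, incr_apply m_inj P hb]
    cases f a <;> rfl
  total c := ⟨_, rfl⟩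
  inj c c' d h h' := Sum.inl.inj (Option.some.inj (h.trans h'.symm))
  cover d := by
    rcases d with c | ⟨b, hb, hP⟩
    · exact Or.inl ⟨c, rfl⟩
    · exact Or.inr ⟨b, hb, incr_off P hb hP⟩
  off_inj b b' d hb hb' h h' := by
    obtain ⟨_, rfl⟩ := incr_off_eq_some hb h
    obtain ⟨_, h2⟩ := incr_off_eq_some hb' h'
    simpa using h2
  off_disj b c d hb h h' := by
    obtain ⟨_, rfl⟩ := incr_off_eq_some hb h
    simp at h'

end GlueSet

/-! ### Partial hypergraph morphisms -/

theorem map_eq_map_bind {A B C : Type*} {l : List A} {l' : List B} {f : A → Option B}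
    (h : l.map f = l'.map some) (k : B → Option C) :
    l'.map k = l.map fun x => (f x).bind k := by
  have := congrArg (List.map fun o : Option B => o.bind k) h
  simpa [List.map_map, Function.comp_def] using this.symm

variable {Λ : Type v} {ar : Λ → ℕ}

instance (G : HGraph.{u} Λ ar) : Finite G.V := G.finV
instance (G : HGraph.{u} Λ ar) : Finite G.E := G.finE

section Morphisms

variable {G H K : HGraph.{u} Λ ar}

theorem nodeMap_comp (f : G ⟶ H) (g : H ⟶ K) (x : G.V) :
    nodeMap (f ≫ g) x = (nodeMap f x).bind (nodeMap g) := rfl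

theorem edgeMap_comp (f : G ⟶ H) (g : H ⟶ K) (e : G.E) :
    edgeMap (f ≫ g) e = (edgeMap f e).bind (edgeMap g) := rfl

theorem hom_ext_maps {f g : G ⟶ H} (hV : nodeMap f = nodeMap g) (hE : edgeMap f = edgeMap g) :
    f = g := PMor.ext hV hE

theorem nodeMap_comp_eq_some {f : G ⟶ H} {g : H ⟶ K} {x : G.V} {z : K.V} :
    nodeMap (f ≫ g) x = some z ↔ ∃ y, nodeMap f x = some y ∧ nodeMap g y = some z :=
  Option.bind_eq_some_iff

theorem edgeMap_comp_eq_some {f : G ⟶ H} {g : H ⟶ K} {x : G.E} {z : K.E} :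
    edgeMap (f ≫ g) x = some z ↔ ∃ y, edgeMap f x = some y ∧ edgeMap g y = some z :=
  Option.bind_eq_some_iff

theorem map_label (f : G ⟶ H) {e : G.E} {e' : H.E} (h : edgeMap f e = some e') :
    H.l e' = G.l e := PMor.map_l f e e' h

theorem map_conn (f : G ⟶ H) {e : G.E} {e' : H.E} (h : edgeMap f e = some e') :
    (G.c e).map (nodeMap f) = (H.c e').map some := PMor.map_c f e e' h

theorem Incident.map {f : G ⟶ H} {e : G.E} {e' : H.E} (h : edgeMap f e = some e') {x : G.V}
    (hx : G.Incident e x) : ∃ y, nodeMap f x = some y ∧ H.Incident e' y := by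
  have h1 : nodeMap f x ∈ (G.c e).map (nodeMap f) := List.mem_map_of_mem hx
  rw [map_conn f h] at h1
  obtain ⟨y, hy, hy'⟩ := List.mem_map.1 h1
  exact ⟨y, hy'.symm, hy⟩

theorem IsTotal.comp {f : G ⟶ H} {g : H ⟶ K} (hf : IsTotal f) (hg : IsTotal g) :
    IsTotal (f ≫ g) := by
  constructor
  · intro x
    obtain ⟨y, hy⟩ := hf.1 x
    obtain ⟨z, hz⟩ := hg.1 y
    exact ⟨z, nodeMap_comp_eq_some.2 ⟨y, hy, hz⟩⟩
  · intro x
    obtain ⟨y, hy⟩ := hf.2 x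
    obtain ⟨z, hz⟩ := hg.2 y
    exact ⟨z, edgeMap_comp_eq_some.2 ⟨y, hy, hz⟩⟩

theorem IsInj.comp {f : G ⟶ H} {g : H ⟶ K} (hf : IsInj f) (hg : IsInj g) : IsInj (f ≫ g) := by
  constructor
  · intro x x' z h h'
    obtain ⟨y, hy, hz⟩ := nodeMap_comp_eq_some.1 h
    obtain ⟨y', hy', hz'⟩ := nodeMap_comp_eq_some.1 h'
    obtain rfl := hg.1 _ _ _ hz hz'
    exact hf.1 _ _ _ hy hy'
  · intro x x' z h h'
    obtain ⟨y, hy, hz⟩ := edgeMap_comp_eq_some.1 h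
    obtain ⟨y', hy', hz'⟩ := edgeMap_comp_eq_some.1 h'
    obtain rfl := hg.2 _ _ _ hz hz'
    exact hf.2 _ _ _ hy hy'

theorem IsSurj.comp {f : G ⟶ H} {g : H ⟶ K} (hf : IsSurj f) (hg : IsSurj g) :
    IsSurj (f ≫ g) := by
  constructor
  · intro z
    obtain ⟨y, hy⟩ := hg.1 z
    obtain ⟨x, hx⟩ := hf.1 y
    exact ⟨x, nodeMap_comp_eq_some.2 ⟨y, hx, hy⟩⟩
  · intro z
    obtain ⟨y, hy⟩ := hg.2 z
    obtain ⟨x, hx⟩ := hf.2 y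
    exact ⟨x, edgeMap_comp_eq_some.2 ⟨y, hx, hy⟩⟩

theorem isTotal_id (G : HGraph.{u} Λ ar) : IsTotal (𝟙 G) := ⟨fun x => ⟨x, rfl⟩, fun e => ⟨e, rfl⟩⟩

theorem isInj_id (G : HGraph.{u} Λ ar) : IsInj (𝟙 G) :=
  ⟨fun _ _ _ h h' => Option.some.inj (h.trans h'.symm),
    fun _ _ _ h h' => Option.some.inj (h.trans h'.symm)⟩

theorem isSurj_id (G : HGraph.{u} Λ ar) : IsSurj (𝟙 G) := ⟨fun x => ⟨x, rfl⟩, fun e => ⟨e, rfl⟩⟩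

theorem IsTotal.of_comp {f : G ⟶ H} {g : H ⟶ K} (h : IsTotal (f ≫ g)) : IsTotal f := by
  constructor
  · intro x
    obtain ⟨z, hz⟩ := h.1 x
    obtain ⟨y, hy, -⟩ := nodeMap_comp_eq_some.1 hz
    exact ⟨y, hy⟩
  · intro x
    obtain ⟨z, hz⟩ := h.2 x
    obtain ⟨y, hy, -⟩ := edgeMap_comp_eq_some.1 hz
    exact ⟨y, hy⟩

theorem IsSurj.of_comp {f : G ⟶ H} {g : H ⟶ K} (h : IsSurj (f ≫ g)) : IsSurj g := by
  constructor
  · intro z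
    obtain ⟨x, hx⟩ := h.1 z
    obtain ⟨y, -, hy⟩ := nodeMap_comp_eq_some.1 hx
    exact ⟨y, hy⟩
  · intro z
    obtain ⟨x, hx⟩ := h.2 z
    obtain ⟨y, -, hy⟩ := edgeMap_comp_eq_some.1 hx
    exact ⟨y, hy⟩

theorem IsInj.of_comp {f : G ⟶ H} {g : H ⟶ K} (h : IsInj (f ≫ g)) (hg : IsTotal g) :
    IsInj f := by
  constructor
  · intro x x' y hx hx'
    obtain ⟨z, hz⟩ := hg.1 y
    exact h.1 _ _ z (nodeMap_comp_eq_some.2 ⟨y, hx, hz⟩) (nodeMap_comp_eq_some.2 ⟨y, hx', hz⟩)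
  · intro x x' y hx hx'
    obtain ⟨z, hz⟩ := hg.2 y
    exact h.2 _ _ z (edgeMap_comp_eq_some.2 ⟨y, hx, hz⟩) (edgeMap_comp_eq_some.2 ⟨y, hx', hz⟩)

theorem isTotal_iso (i : G ≅ H) : IsTotal i.hom :=
  IsTotal.of_comp (g := i.inv) (by rw [i.hom_inv_id]; exact isTotal_id G)

theorem isInj_iso (i : G ≅ H) : IsInj i.hom :=
  IsInj.of_comp (g := i.inv) (by rw [i.hom_inv_id]; exact isInj_id G) (isTotal_iso i.symm)

theorem isSurj_iso (i : G ≅ H) : IsSurj i.hom :=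
  IsSurj.of_comp (f := i.inv) (by rw [i.inv_hom_id]; exact isSurj_id H)

end Morphisms

/-! ### Pushouts along total injective morphisms -/

/-- The explicit description of pushouts along total injective morphisms `m`. -/
structure IsGluing {A B C D : HGraph.{u} Λ ar} (f : A ⟶ C) (m : A ⟶ B) (n : C ⟶ D)
    (g : B ⟶ D) : Prop where
  node : GlueSet (nodeMap f) (nodeMap m) (nodeMap n) (nodeMap g)
  edge : GlueSet (edgeMap f) (edgeMap m) (edgeMap n) (edgeMap g)
  node_off : ∀ b, (∀ a, nodeMap m a ≠ some b) → ∃ d, nodeMap g b = some d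
  edge_off : ∀ b, (∀ a, edgeMap m a ≠ some b) →
    (∀ x, B.Incident b x → ∃ d, nodeMap g x = some d) → ∃ d, edgeMap g b = some d

section Gluing

variable {A B C D : HGraph.{u} Λ ar} {f : A ⟶ C} {m : A ⟶ B} {n : C ⟶ D} {g : B ⟶ D}

theorem IsGluing.w (h : IsGluing f m n g) : f ≫ n = m ≫ g :=
  hom_ext_maps (funext h.node.comm) (funext h.edge.comm)

theorem nodeMap_eq_of_w {X : HGraph.{u} Λ ar} {x : C ⟶ X} {y : B ⟶ X} (hxy : f ≫ x = m ≫ y)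
    (a : A.V) : (nodeMap f a).bind (nodeMap x) = (nodeMap m a).bind (nodeMap y) :=
  congrFun (congrArg nodeMap hxy) a

theorem edgeMap_eq_of_w {X : HGraph.{u} Λ ar} {x : C ⟶ X} {y : B ⟶ X} (hxy : f ≫ x = m ≫ y)
    (a : A.E) : (edgeMap f a).bind (edgeMap x) = (edgeMap m a).bind (edgeMap y) :=
  congrFun (congrArg edgeMap hxy) a

/-- The point is that `y` is undefined wherever `g` is: such a node is `m a` with `f a` undefined,
and commutativity of the cocone makes `y` undefined there. -/
theorem IsGluing.desc_node (h : IsGluing f m n g) {X : HGraph.{u} Λ ar}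
    {x : C ⟶ X} {y : B ⟶ X} (hxy : f ≫ x = m ≫ y) (b : B.V) :
    (nodeMap g b).bind (GlueSet.desc (nodeMap n) (nodeMap g) (nodeMap x) (nodeMap y)) =
      nodeMap y b := by
  cases hb : nodeMap g b with
  | some d => exact h.node.desc_right_of_eq_some (nodeMap_eq_of_w hxy) hb
  | none =>
    by_cases hm : ∃ a, nodeMap m a = some b
    · obtain ⟨a, ha⟩ := hm
      have h1 := h.node.comm a
      have h2 := nodeMap_eq_of_w hxy a
      rw [ha, Option.bind_some] at h1 h2
      rw [hb] at h1
      cases hf : nodeMap f a with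
      | none => rw [← h2, hf]; rfl
      | some c =>
        obtain ⟨d, hd⟩ := h.node.total c
        simp [hf, hd] at h1
    · push Not at hm
      obtain ⟨d, hd⟩ := h.node_off b hm
      simp [hd] at hb

theorem IsGluing.desc_edge (h : IsGluing f m n g) {X : HGraph.{u} Λ ar}
    {x : C ⟶ X} {y : B ⟶ X} (hxy : f ≫ x = m ≫ y) (b : B.E) :
    (edgeMap g b).bind (GlueSet.desc (edgeMap n) (edgeMap g) (edgeMap x) (edgeMap y)) =
      edgeMap y b := by
  cases hb : edgeMap g b with
  | some d => exact h.edge.desc_right_of_eq_some (edgeMap_eq_of_w hxy) hb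
  | none =>
    by_cases hm : ∃ a, edgeMap m a = some b
    · obtain ⟨a, ha⟩ := hm
      have h1 := h.edge.comm a
      have h2 := edgeMap_eq_of_w hxy a
      rw [ha, Option.bind_some] at h1 h2
      rw [hb] at h1
      cases hf : edgeMap f a with
      | none => rw [← h2, hf]; rfl
      | some c =>
        obtain ⟨d, hd⟩ := h.edge.total c
        simp [hf, hd] at h1
    · push Not at hm
      by_contra hne
      obtain ⟨e', he'⟩ := Option.ne_none_iff_exists'.1 (Ne.symm hne)
      -- If `y` were defined on this edge, it would be defined on its nodes; by `desc_node` so would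
      -- `g`, and the edge would survive.
      obtain ⟨d, hd⟩ := h.edge_off b hm (fun z hz => by
        obtain ⟨w, hw, -⟩ := Incident.map he' hz
        have h3 := h.desc_node hxy z
        rw [hw] at h3
        obtain ⟨d, hd, -⟩ := Option.bind_eq_some_iff.1 h3
        exact ⟨d, hd⟩)
      simp [hd] at hb

/-- The morphism out of a gluing that is determined by its restrictions to the two parts. -/
noncomputable def IsGluing.desc (h : IsGluing f m n g) {X : HGraph.{u} Λ ar}
    (x : C ⟶ X) (y : B ⟶ X) (hxy : f ≫ x = m ≫ y) : D ⟶ X where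
  fV := GlueSet.desc (nodeMap n) (nodeMap g) (nodeMap x) (nodeMap y)
  fE := GlueSet.desc (edgeMap n) (edgeMap g) (edgeMap x) (edgeMap y)
  map_l d e' hd := by
    rcases h.edge.cover d with ⟨c, hc⟩ | ⟨b, -, hb⟩
    · have h1 := h.edge.desc_left (edgeMap x) (edgeMap y) c
      rw [hc, Option.bind_some, hd] at h1
      rw [map_label n hc, map_label x h1.symm]
    · have h1 := h.edge.desc_right_of_eq_some (edgeMap_eq_of_w hxy) hb
      rw [hd] at h1
      rw [map_label g hb, map_label y h1.symm]
  map_c d e' hd := by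
    rcases h.edge.cover d with ⟨c, hc⟩ | ⟨b, -, hb⟩
    · have h1 := h.edge.desc_left (edgeMap x) (edgeMap y) c
      rw [hc, Option.bind_some, hd] at h1
      rw [map_eq_map_bind (map_conn n hc), ← map_conn x h1.symm]
      exact List.map_congr_left fun z _ => h.node.desc_left _ _ z
    · have h1 := h.edge.desc_right_of_eq_some (edgeMap_eq_of_w hxy) hb
      rw [hd] at h1
      rw [map_eq_map_bind (map_conn g hb), ← map_conn y h1.symm]
      exact List.map_congr_left fun z _ => h.desc_node hxy z

theorem IsGluing.isPushout (h : IsGluing f m n g) : IsPushout f m n g := by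
  refine ⟨⟨h.w⟩, ⟨Limits.PushoutCocone.IsColimit.mk h.w
    (fun s => h.desc s.inl s.inr s.condition) (fun s => ?_) (fun s => ?_)
    (fun s k h1 h2 => ?_)⟩⟩
  · exact hom_ext_maps (funext fun c => h.node.desc_left _ _ c)
      (funext fun c => h.edge.desc_left _ _ c)
  · exact hom_ext_maps (funext fun c => h.desc_node s.condition c)
      (funext fun c => h.desc_edge s.condition c)
  · refine hom_ext_maps (h.node.hom_ext (fun c => ?_) (fun b => ?_))
      (h.edge.hom_ext (fun c => ?_) (fun b => ?_))
    · exact (congrFun (congrArg nodeMap h1) c).trans (h.node.desc_left _ _ c).symm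
    · exact (congrFun (congrArg nodeMap h2) b).trans (h.desc_node s.condition b).symm
    · exact (congrFun (congrArg edgeMap h1) c).trans (h.edge.desc_left _ _ c).symm
    · exact (congrFun (congrArg edgeMap h2) b).trans (h.desc_edge s.condition b).symm

theorem IsGluing.comp_iso (h : IsGluing f m n g) {D' : HGraph.{u} Λ ar} (i : D ≅ D') :
    IsGluing f m (n ≫ i.hom) (g ≫ i.hom) where
  node := h.node.comp_bijective (isTotal_iso i).1 (isInj_iso i).1 (isSurj_iso i).1
  edge := h.edge.comp_bijective (isTotal_iso i).2 (isInj_iso i).2 (isSurj_iso i).2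
  node_off b hb := by
    obtain ⟨d, hd⟩ := h.node_off b hb
    obtain ⟨d', hd'⟩ := (isTotal_iso i).1 d
    exact ⟨d', nodeMap_comp_eq_some.2 ⟨d, hd, hd'⟩⟩
  edge_off b hb hx := by
    obtain ⟨d, hd⟩ := h.edge_off b hb fun x hbx => by
      obtain ⟨d', hd'⟩ := hx x hbx
      obtain ⟨d, hd, -⟩ := nodeMap_comp_eq_some.1 hd'
      exact ⟨d, hd⟩
    obtain ⟨d', hd'⟩ := (isTotal_iso i).2 d
    exact ⟨d', edgeMap_comp_eq_some.2 ⟨d, hd, hd'⟩⟩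

theorem map_some_filterMap {X Y : Type*} {k : X → Option Y} {l : List X}
    (h : ∀ x ∈ l, ∃ y, k x = some y) : (l.filterMap k).map some = l.map k := by
  induction l with
  | nil => rfl
  | cons a l ih =>
    obtain ⟨y, hy⟩ := h a (by simp)
    simp [hy, ih fun x hx => h x (by simp [hx])]

theorem exists_isGluing (f : A ⟶ C) {m : A ⟶ B} (mt : IsTotal m) (mi : IsInj m) :
    ∃ (D : HGraph.{u} Λ ar) (n : C ⟶ D) (g : B ⟶ D), IsGluing f m n g := by
  let gV := GlueSet.incr (nodeMap f) (nodeMap m) (fun _ => True)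
  let P : B.E → Prop := fun e => ∀ x ∈ B.c e, ∃ d, gV x = some d
  let gE := GlueSet.incr (edgeMap f) (edgeMap m) P
  have hV : GlueSet (nodeMap f) (nodeMap m) (fun c => some (Sum.inl c)) gV :=
    GlueSet.glueSet_incr mt.1 mi.1 _
  have hE : GlueSet (edgeMap f) (edgeMap m) (fun c => some (Sum.inl c)) gE :=
    GlueSet.glueSet_incr mt.2 mi.2 _
  let D : HGraph.{u} Λ ar :=
    { V := C.V ⊕ {b : B.V // (∀ a, nodeMap m a ≠ some b) ∧ True}
      E := C.E ⊕ {b : B.E // (∀ a, edgeMap m a ≠ some b) ∧ P b}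
      finV := inferInstance
      finE := inferInstance
      -- `filterMap` discards nothing here, since `P` says that all nodes of the edge survive; hence
      -- the arity is preserved.
      c := Sum.elim (fun e => (C.c e).map Sum.inl) (fun e => (B.c e.1).filterMap gV)
      l := Sum.elim C.l (fun e => B.l e.1)
      length_c := by
        rintro (e | ⟨e, he, hP⟩)
        · simpa using C.length_c e
        · have := congrArg List.length (map_some_filterMap hP)
          simp only [List.length_map] at this
          exact this.trans (B.length_c e) }
  let n : C ⟶ D :=
    { fV := fun c => some (Sum.inl c)
      fE := fun c => some (Sum.inl c)
      map_l := by rintro e e' h; cases h; rfl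
      map_c := by rintro e e' h; cases h; simp [D, Function.comp_def] }
  let g : B ⟶ D :=
    { fV := gV
      fE := gE
      map_l := by
        intro e e' h
        by_cases hm : ∃ a, edgeMap m a = some e
        · obtain ⟨a, ha⟩ := hm
          simp only [gE] at h
          rw [GlueSet.incr_apply mi.2 P ha, Option.map_eq_some_iff] at h
          obtain ⟨c, hc, rfl⟩ := h
          exact (map_label f hc).trans (map_label m ha).symm
        · push Not at hm
          obtain ⟨_, rfl⟩ := GlueSet.incr_off_eq_some hm h
          rfl
      map_c := by
        intro e e' h
        by_cases hm : ∃ a, edgeMap m a = some e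
        · obtain ⟨a, ha⟩ := hm
          simp only [gE] at h
          rw [GlueSet.incr_apply mi.2 P ha, Option.map_eq_some_iff] at h
          obtain ⟨c, hc, rfl⟩ := h
          have h1 := map_eq_map_bind (map_conn f hc)
            (fun c => (some (Sum.inl c) : Option D.V))
          have h2 : (D.c (Sum.inl c)).map some = (C.c c).map fun c => some (Sum.inl c) := by
            simp [D, Function.comp_def]
          rw [map_eq_map_bind (map_conn m ha), h2, h1]
          exact List.map_congr_left fun x _ => (hV.comm x).symm
        · push Not at hm
          obtain ⟨hP, rfl⟩ := GlueSet.incr_off_eq_some hm h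
          exact (map_some_filterMap hP).symm }
  refine ⟨D, n, g, hV, hE, fun b hb => ⟨_, GlueSet.incr_off (fun _ => True) hb trivial⟩,
    fun b hb hx => ⟨_, GlueSet.incr_off P hb hx⟩⟩

/-- Pushouts are unique up to isomorphism, so the explicit description transfers from the
constructed gluing to any pushout. -/
theorem isGluing_of_isPushout (h : IsPushout f m n g) (mt : IsTotal m) (mi : IsInj m) :
    IsGluing f m n g := by
  obtain ⟨D', n', g', h'⟩ := exists_isGluing f mt mi
  have hp := h'.isPushout
  have := h'.comp_iso (hp.isoIsPushout _ _ h)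
  simpa using this

theorem exists_isPushout (f : A ⟶ C) {m : A ⟶ B} (mt : IsTotal m) (mi : IsInj m) :
    ∃ (D : HGraph.{u} Λ ar) (n : C ⟶ D) (g : B ⟶ D), IsPushout f m n g := by
  obtain ⟨D, n, g, h⟩ := exists_isGluing f mt mi
  exact ⟨D, n, g, h.isPushout⟩

theorem IsGluing.isTotal (h : IsGluing f m n g) : IsTotal n := ⟨h.node.total, h.edge.total⟩

theorem IsGluing.isInj (h : IsGluing f m n g) : IsInj n := ⟨h.node.inj, h.edge.inj⟩

end Gluing

/-! ### Subgraphs and restrictions of morphisms -/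

section Restriction

variable (G : HGraph.{u} Λ ar) (P : Set G.V) (Q : Set G.E) (hPQ : ∀ e ∈ Q, ∀ x ∈ G.c e, x ∈ P)

/-- The subgraph of `G` with nodes `P` and edges `Q`. -/
def restrict : HGraph.{u} Λ ar where
  V := P
  E := Q
  finV := inferInstance
  finE := inferInstance
  c e := (G.c e.1).attachWith (· ∈ P) (hPQ e.1 e.2)
  l e := G.l e.1
  length_c e := by simpa using G.length_c e.1

/-- The inclusion of a subgraph. -/
def restrictIncl : G.restrict P Q hPQ ⟶ G where
  fV := fun x : P => some x.1
  fE := fun e : Q => some e.1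
  map_l := by rintro e e' h; cases h; rfl
  map_c := by
    rintro e e' h
    cases h
    have := congrArg (List.map some) (List.attachWith_map_subtype_val (hPQ e.1 e.2))
    rwa [List.map_map] at this

open Classical in
/-- The partial morphism from a graph to a subgraph that is the identity where it is defined. -/
noncomputable def restrictRes : G ⟶ G.restrict P Q hPQ where
  fV := fun x => if h : x ∈ P then some ⟨x, h⟩ else none
  fE := fun x => if h : x ∈ Q then some ⟨x, h⟩ else none
  map_l e e' h := by
    split_ifs at h with h'
    cases h
    rfl
  map_c e e' h := by
    split_ifs at h with h'
    cases h
    have : G.c e = ((G.restrict P Q hPQ).c ⟨e, h'⟩).map Subtype.val :=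
      (List.attachWith_map_subtype_val (hPQ e h')).symm
    rw [this]
    exact List.map_map.trans (List.map_congr_left fun x _ => dif_pos x.2)

variable {G P Q hPQ}

theorem edgeMap_restrictIncl (x : (G.restrict P Q hPQ).E) :
    edgeMap (G.restrictIncl P Q hPQ) x = some x.1 := rfl

theorem nodeMap_restrictRes {x : G.V} (h : x ∈ P) :
    nodeMap (G.restrictRes P Q hPQ) x = some ⟨x, h⟩ := dif_pos h

theorem edgeMap_restrictRes {x : G.E} (h : x ∈ Q) :
    edgeMap (G.restrictRes P Q hPQ) x = some ⟨x, h⟩ := dif_pos h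

theorem nodeMap_restrictRes_eq_some {x : G.V} {y : (G.restrict P Q hPQ).V}
    (h : nodeMap (G.restrictRes P Q hPQ) x = some y) : y.1 = x := by
  by_cases hx : x ∈ P
  · rw [nodeMap_restrictRes hx] at h
    cases h
    rfl
  · have : nodeMap (G.restrictRes P Q hPQ) x = none := dif_neg hx
    simp [this] at h

theorem edgeMap_restrictRes_eq_some {x : G.E} {y : (G.restrict P Q hPQ).E}
    (h : edgeMap (G.restrictRes P Q hPQ) x = some y) : y.1 = x := by
  by_cases hx : x ∈ Q
  · rw [edgeMap_restrictRes hx] at h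
    cases h
    rfl
  · have : edgeMap (G.restrictRes P Q hPQ) x = none := dif_neg hx
    simp [this] at h

theorem isTotal_restrictIncl : IsTotal (G.restrictIncl P Q hPQ) :=
  ⟨fun _ => ⟨_, rfl⟩, fun _ => ⟨_, rfl⟩⟩

theorem isInj_restrictIncl : IsInj (G.restrictIncl P Q hPQ) :=
  ⟨fun _ _ _ h h' => Subtype.ext (Option.some.inj (h.trans h'.symm)),
    fun _ _ _ h h' => Subtype.ext (Option.some.inj (h.trans h'.symm))⟩

theorem isSubgraphMor_restrictRes : IsSubgraphMor (G.restrictRes P Q hPQ) :=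
  ⟨⟨fun _ _ _ h h' => (nodeMap_restrictRes_eq_some h).symm.trans (nodeMap_restrictRes_eq_some h'),
    fun _ _ _ h h' => (edgeMap_restrictRes_eq_some h).symm.trans (edgeMap_restrictRes_eq_some h')⟩,
    fun y => ⟨y.1, nodeMap_restrictRes y.2⟩, fun y => ⟨y.1, edgeMap_restrictRes y.2⟩⟩

theorem subOrder_restrict : SubOrder (G.restrict P Q hPQ) G := ⟨_, isSubgraphMor_restrictRes⟩

/-- A morphism all of whose values lie in a subgraph factors through it. -/
theorem restrictRes_comp_incl {K : HGraph.{u} Λ ar} (f : K ⟶ G)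
    (hV : ∀ x y, nodeMap f x = some y → y ∈ P) (hE : ∀ x y, edgeMap f x = some y → y ∈ Q) :
    (f ≫ G.restrictRes P Q hPQ) ≫ G.restrictIncl P Q hPQ = f := by
  refine hom_ext_maps (funext fun x => ?_) (funext fun x => ?_)
  · rw [nodeMap_comp, nodeMap_comp]
    cases h : nodeMap f x with
    | none => rfl
    | some y => rw [Option.bind_some, nodeMap_restrictRes (hV _ _ h)]; rfl
  · rw [edgeMap_comp, edgeMap_comp]
    cases h : edgeMap f x with
    | none => rfl
    | some y => rw [Option.bind_some, edgeMap_restrictRes (hE _ _ h)]; rfl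

/-- The restriction of a morphism to a subgraph containing its domain. -/
theorem restrictRes_comp_restrictIncl_comp {K : HGraph.{u} Λ ar} (f : G ⟶ K)
    (hV : ∀ x y, nodeMap f x = some y → x ∈ P) (hE : ∀ x y, edgeMap f x = some y → x ∈ Q) :
    G.restrictRes P Q hPQ ≫ G.restrictIncl P Q hPQ ≫ f = f := by
  refine hom_ext_maps (funext fun x => ?_) (funext fun x => ?_)
  · rw [nodeMap_comp]
    by_cases h : x ∈ P
    · rw [nodeMap_restrictRes h]; rfl
    · cases h' : nodeMap f x with
      | some y => exact absurd (hV _ _ h') h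
      | none =>
        have : nodeMap (G.restrictRes P Q hPQ) x = none := dif_neg h
        rw [this]; rfl
  · rw [edgeMap_comp]
    by_cases h : x ∈ Q
    · rw [edgeMap_restrictRes h]; rfl
    · cases h' : edgeMap f x with
      | some y => exact absurd (hE _ _ h') h
      | none =>
        have : edgeMap (G.restrictRes P Q hPQ) x = none := dif_neg h
        rw [this]; rfl

end Restriction

/-! ### Subgraph order, path bound and minimality by counting -/

theorem SubOrder.trans {G₁ G₂ G₃ : HGraph.{u} Λ ar} (h : SubOrder G₁ G₂) (h' : SubOrder G₂ G₃) :
    SubOrder G₁ G₃ := by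
  obtain ⟨μ, h1, h2⟩ := h
  obtain ⟨ν, h3, h4⟩ := h'
  exact ⟨ν ≫ μ, h3.comp h1, h4.comp h2⟩

/-- A total injective morphism carries an undirected path to one of the same length. -/
theorem mem_boundedPath_of_isInj {k : ℕ} {S G : HGraph.{u} Λ ar} (j : S ⟶ G) (jt : IsTotal j)
    (ji : IsInj j) (hG : G ∈ boundedPath k) : S ∈ boundedPath k := by
  rintro n x e ⟨hx, he, hinc⟩
  choose jV hV using jt.1
  choose jE hE using jt.2
  refine hG n (jV ∘ x) (jE ∘ e) ⟨fun a b hab => hx (ji.1 _ _ _ (hV _) ?_),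
    fun a b hab => he (ji.2 _ _ _ (hE _) ?_), fun i => ?_⟩
  · rw [hV]; exact congrArg some hab.symm
  · rw [hE]; exact congrArg some hab.symm
  · have key : ∀ d z, S.Incident d z → G.Incident (jE d) (jV z) := by
      intro d z hdz
      obtain ⟨y, hy, hy'⟩ := hdz.map (hE d)
      rw [hV] at hy
      cases hy
      exact hy'
    exact ⟨key _ _ (hinc i).1, key _ _ (hinc i).2⟩

section Counting

theorem exists_bijective_inverse {X Y : Type*} [Finite X] {k : X → Option Y}
    (hs : ∀ y, ∃ x, k x = some y) (hc : Nat.card X ≤ Nat.card Y) :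
    ∃ s : Y → X, Function.Bijective s ∧ ∀ y, k (s y) = some y := by
  choose s hs using hs
  have hi : Function.Injective s := fun y y' h => Option.some.inj (by rw [← hs, ← hs, h])
  exact ⟨s, hi.bijective_of_nat_card_le hc, hs⟩

/-- A subgraph of `G` with at least as many nodes and edges as `G` is isomorphic to `G`. -/
theorem SubOrder.symm_of_card_le {G H : HGraph.{u} Λ ar} (h : SubOrder H G)
    (hV : Nat.card G.V ≤ Nat.card H.V) (hE : Nat.card G.E ≤ Nat.card H.E) : SubOrder G H := by
  obtain ⟨ν, -, h2⟩ := h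
  obtain ⟨s, hs, hs'⟩ := exists_bijective_inverse h2.1 hV
  obtain ⟨t, ht, ht'⟩ := exists_bijective_inverse h2.2 hE
  let σ : H ⟶ G :=
    { fV := fun y => some (s y)
      fE := fun y => some (t y)
      map_l := by
        rintro e e' h
        cases h
        exact (map_label ν (ht' e)).symm
      map_c := by
        rintro e e' h
        cases h
        rw [map_eq_map_bind (map_conn ν (ht' e)) fun y => some (s y)]
        refine List.map_congr_left fun x _ => ?_
        -- Surjectivity of the section `s` makes `ν` defined at every node of `G`, with inverse `s`.
        obtain ⟨y, rfl⟩ := hs.2 x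
        rw [hs']; rfl }
  refine ⟨σ, ⟨fun x x' y hx hx' => hs.1 (Option.some.inj (hx.trans hx'.symm)),
    fun x x' y hx hx' => ht.1 (Option.some.inj (hx.trans hx'.symm))⟩, fun y => ?_, fun y => ?_⟩
  · obtain ⟨x, rfl⟩ := hs.2 y
    exact ⟨x, rfl⟩
  · obtain ⟨x, rfl⟩ := ht.2 y
    exact ⟨x, rfl⟩

/-- A pushout complement in which every edge outside the match survives is minimal. -/
theorem IsGluing.subOrder_of_complement {L R G G' : HGraph.{u} Λ ar} {φ : L ⟶ R} {m : L ⟶ G'}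
    {m' : R ⟶ G} {φ' : G' ⟶ G} (h : IsGluing φ m m' φ')
    (hE : ∀ e, (∀ d, edgeMap m d ≠ some e) → ∃ e', edgeMap φ' e = some e')
    {k : ℕ} {H : HGraph.{u} Λ ar} (hH : H ∈ complements k φ m') (hHG : SubOrder H G') :
    SubOrder G' H := by
  obtain ⟨-, n, nt, ni, ψ, hψ⟩ := hH
  have h' := isGluing_of_isPushout hψ nt ni
  exact hHG.symm_of_card_le (h.node.card_le h'.node nt.1 ni.1 h.node_off)
    (h.edge.card_le h'.edge nt.2 ni.2 hE)

end Counting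

/-! ### Restricting pushout complements -/

/-- Restriction of a pushout complement: given a pushout of `γ` and `m`, a subgraph morphism `σ` out
of it and a total injective `a : L₀ ⟶ L` whose range contains the nodes of `L` that survive, the
part of `G'` that survives or comes from `L₀` is a pushout complement again. -/
theorem exists_sub_complement {L R G' H G L₀ R' : HGraph.{u} Λ ar} {γ : L ⟶ R} {m : L ⟶ G'}
    {n : R ⟶ H} {φ' : G' ⟶ H} (hg : IsGluing γ m n φ') (mt : IsTotal m) (mi : IsInj m)
    {σ : H ⟶ G} (hσ : IsSubgraphMor σ) {a : L₀ ⟶ L} (at' : IsTotal a) (ai : IsInj a)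
    {φ₀ : L₀ ⟶ R'} {m' : R' ⟶ G} (mt' : IsTotal m') (mi' : IsInj m')
    (hw : φ₀ ≫ m' = a ≫ γ ≫ n ≫ σ)
    (haV : ∀ y z, nodeMap (γ ≫ n ≫ σ) y = some z → ∃ x, nodeMap a x = some y)
    (hV : ∀ z, (∃ r, nodeMap m' r = some z) ↔ ∃ r, nodeMap (n ≫ σ) r = some z)
    (hE : ∀ z, (∃ r, edgeMap m' r = some z) ↔ ∃ r, edgeMap (n ≫ σ) r = some z) :
    ∃ (G₀ : HGraph.{u} Λ ar) (m₀ : L₀ ⟶ G₀) (ψ : G₀ ⟶ G) (j : G₀ ⟶ G'),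
      IsTotal m₀ ∧ IsInj m₀ ∧ IsGluing φ₀ m₀ m' ψ ∧ IsTotal j ∧ IsInj j ∧ m₀ ≫ j = a ≫ m ∧
      SubOrder G₀ G' ∧
      (∀ e, (∀ d, edgeMap m₀ d ≠ some e) → ∃ e', edgeMap ψ e = some e') ∧
      (∀ e e' d, edgeMap j e = some e' → edgeMap m d = some e' →
        ∃ d', edgeMap m₀ d' = some e) := by
  have hwm : γ ≫ n ≫ σ = m ≫ φ' ≫ σ := by
    rw [← Category.assoc, hg.w, Category.assoc]
  -- Keep the image of `L₀` and the elements outside the whole match `m` that reach `G`; the rest of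
  -- the match is dropped.
  let P : Set G'.V := {x | (∃ y, nodeMap (a ≫ m) y = some x) ∨
    ((∀ y, nodeMap m y ≠ some x) ∧ ∃ z, nodeMap (φ' ≫ σ) x = some z)}
  let Q : Set G'.E := {x | (∃ y, edgeMap (a ≫ m) y = some x) ∨
    ((∀ y, edgeMap m y ≠ some x) ∧ ∃ z, edgeMap (φ' ≫ σ) x = some z)}
  have hPQ : ∀ e ∈ Q, ∀ x ∈ G'.c e, x ∈ P := by
    rintro e (⟨d, hd⟩ | ⟨-, e', he'⟩) x hx
    · have h1 : some x ∈ (G'.c e).map some := List.mem_map_of_mem hx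
      rw [← map_conn _ hd] at h1
      obtain ⟨y, -, hy⟩ := List.mem_map.1 h1
      exact Or.inl ⟨y, hy⟩
    · obtain ⟨z, hz, -⟩ := Incident.map he' hx
      by_cases hm : ∃ y, nodeMap m y = some x
      -- A surviving edge outside the match may touch the match, but only at surviving nodes, which
      -- `haV` places in the range of `a`.
      · obtain ⟨y, hy⟩ := hm
        obtain ⟨w, hw'⟩ := haV y z (by
          rw [hwm]
          exact nodeMap_comp_eq_some.2 ⟨x, hy, hz⟩)
        exact Or.inl ⟨w, nodeMap_comp_eq_some.2 ⟨y, hw', hy⟩⟩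
      · push Not at hm
        exact Or.inr ⟨hm, z, hz⟩
  let j := G'.restrictIncl P Q hPQ
  let m₀ : L₀ ⟶ G'.restrict P Q hPQ := (a ≫ m) ≫ G'.restrictRes P Q hPQ
  have hm₀ : m₀ ≫ j = a ≫ m :=
    restrictRes_comp_incl _ (fun x y h => Or.inl ⟨x, h⟩) (fun x y h => Or.inl ⟨x, h⟩)
  have m₀t : IsTotal m₀ := IsTotal.of_comp (g := j) (by rw [hm₀]; exact at'.comp mt)
  have m₀i : IsInj m₀ :=
    IsInj.of_comp (g := j) (by rw [hm₀]; exact ai.comp mi) isTotal_restrictIncl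
  have offV : ∀ b, (∀ y, nodeMap m₀ y ≠ some b) →
      (∀ y, nodeMap m y ≠ some b.1) ∧ ∃ z, nodeMap (φ' ≫ σ) b.1 = some z := by
    rintro ⟨b, ⟨y, hy⟩ | hb⟩ hb'
    · exact absurd (nodeMap_comp_eq_some.2 ⟨b, hy, nodeMap_restrictRes _⟩) (hb' y)
    · exact hb
  have offE : ∀ b, (∀ y, edgeMap m₀ y ≠ some b) →
      (∀ y, edgeMap m y ≠ some b.1) ∧ ∃ z, edgeMap (φ' ≫ σ) b.1 = some z := by
    rintro ⟨b, ⟨y, hy⟩ | hb⟩ hb'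
    · exact absurd (edgeMap_comp_eq_some.2 ⟨b, hy, edgeMap_restrictRes _⟩) (hb' y)
    · exact hb
  have hw₀ : φ₀ ≫ m' = m₀ ≫ j ≫ φ' ≫ σ := by
    rw [hw, hwm, ← Category.assoc m₀, hm₀, Category.assoc]
  have gV : GlueSet (nodeMap φ₀) (nodeMap m₀) (nodeMap m') (nodeMap (j ≫ φ' ≫ σ)) := by
    refine ⟨nodeMap_eq_of_w hw₀, mt'.1, mi'.1, fun d => ?_, fun b b' d hb hb' h h' => ?_,
      fun b c d hb h h' => ?_⟩
    · obtain ⟨h, hh⟩ := hσ.2.1 d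
      rcases hg.node.cover h with ⟨c, hc⟩ | ⟨b, hb, hb'⟩
      · exact Or.inl ((hV d).2 ⟨c, nodeMap_comp_eq_some.2 ⟨h, hc, hh⟩⟩)
      · have hbd : nodeMap (φ' ≫ σ) b = some d := nodeMap_comp_eq_some.2 ⟨h, hb', hh⟩
        refine Or.inr ⟨⟨b, Or.inr ⟨hb, d, hbd⟩⟩, fun y hy => ?_, hbd⟩
        obtain ⟨x, hx, hx'⟩ := nodeMap_comp_eq_some.1 hy
        obtain rfl := nodeMap_restrictRes_eq_some hx'
        obtain ⟨w, -, hw'⟩ := nodeMap_comp_eq_some.1 hx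
        exact hb w hw'
    · obtain ⟨z, hz, hz'⟩ := nodeMap_comp_eq_some.1 (show nodeMap (φ' ≫ σ) b.1 = some d from h)
      obtain ⟨w, hw, hw'⟩ := nodeMap_comp_eq_some.1 (show nodeMap (φ' ≫ σ) b'.1 = some d from h')
      obtain rfl := hσ.1.1 _ _ _ hz' hw'
      exact Subtype.ext (hg.node.off_inj _ _ _ (offV b hb).1 (offV b' hb').1 hz hw)
    · obtain ⟨z, hz, hz'⟩ := nodeMap_comp_eq_some.1 (show nodeMap (φ' ≫ σ) b.1 = some d from h)
      obtain ⟨r, hr⟩ := (hV d).1 ⟨c, h'⟩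
      obtain ⟨w, hw, hw'⟩ := nodeMap_comp_eq_some.1 hr
      obtain rfl := hσ.1.1 _ _ _ hz' hw'
      exact hg.node.off_disj _ _ _ (offV b hb).1 hz hw
  have gE : GlueSet (edgeMap φ₀) (edgeMap m₀) (edgeMap m') (edgeMap (j ≫ φ' ≫ σ)) := by
    refine ⟨edgeMap_eq_of_w hw₀, mt'.2, mi'.2, fun d => ?_, fun b b' d hb hb' h h' => ?_,
      fun b c d hb h h' => ?_⟩
    · obtain ⟨h, hh⟩ := hσ.2.2 d
      rcases hg.edge.cover h with ⟨c, hc⟩ | ⟨b, hb, hb'⟩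
      · exact Or.inl ((hE d).2 ⟨c, edgeMap_comp_eq_some.2 ⟨h, hc, hh⟩⟩)
      · have hbd : edgeMap (φ' ≫ σ) b = some d := edgeMap_comp_eq_some.2 ⟨h, hb', hh⟩
        refine Or.inr ⟨⟨b, Or.inr ⟨hb, d, hbd⟩⟩, fun y hy => ?_, hbd⟩
        obtain ⟨x, hx, hx'⟩ := edgeMap_comp_eq_some.1 hy
        obtain rfl := edgeMap_restrictRes_eq_some hx'
        obtain ⟨w, -, hw'⟩ := edgeMap_comp_eq_some.1 hx
        exact hb w hw'
    · obtain ⟨z, hz, hz'⟩ := edgeMap_comp_eq_some.1 (show edgeMap (φ' ≫ σ) b.1 = some d from h)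
      obtain ⟨w, hw, hw'⟩ := edgeMap_comp_eq_some.1 (show edgeMap (φ' ≫ σ) b'.1 = some d from h')
      obtain rfl := hσ.1.2 _ _ _ hz' hw'
      exact Subtype.ext (hg.edge.off_inj _ _ _ (offE b hb).1 (offE b' hb').1 hz hw)
    · obtain ⟨z, hz, hz'⟩ := edgeMap_comp_eq_some.1 (show edgeMap (φ' ≫ σ) b.1 = some d from h)
      obtain ⟨r, hr⟩ := (hE d).1 ⟨c, h'⟩
      obtain ⟨w, hw, hw'⟩ := edgeMap_comp_eq_some.1 hr
      obtain rfl := hσ.1.2 _ _ _ hz' hw'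
      exact hg.edge.off_disj _ _ _ (offE b hb).1 hz hw
  refine ⟨_, m₀, j ≫ φ' ≫ σ, j, m₀t, m₀i, ⟨gV, gE, fun b hb => (offV b hb).2,
    fun b hb _ => (offE b hb).2⟩, isTotal_restrictIncl, isInj_restrictIncl, hm₀,
    subOrder_restrict, fun b hb => (offE b hb).2, fun e e' d he hd => ?_⟩
  -- A kept edge outside `m₀` was kept for lying outside `m`.
  by_contra hcon
  push Not at hcon
  have h1 := (offE e hcon).1 d
  rw [edgeMap_restrictIncl] at he
  cases he
  exact h1 hd

/-! ### Shortening instantiations -/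

section Instantiations

theorem UQuant.isTotal_comp {L : HGraph.{u} Λ ar} (w : UQuant L) : IsTotal (w.p ≫ w.q) :=
  ⟨fun x => (w.node_cond x).imp fun _ h => h.1, fun x => (w.edge_cond x).imp fun _ h => h.1⟩

/-- Because of the unique-preimage condition, the pushout of right-hand sides is also along a total
injective morphism. -/
theorem UQuant.isInj_comp {L : HGraph.{u} Λ ar} (w : UQuant L) : IsInj (w.p ≫ w.q) := by
  constructor
  · intro x x' y h h'
    obtain ⟨y₀, h1, h2⟩ := w.node_cond x
    obtain rfl := Option.some.inj (h1.symm.trans h)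
    obtain ⟨z, hz, hz'⟩ := nodeMap_comp_eq_some.1 h'
    exact w.p_inj.1 _ _ _ (h2 z hz') hz
  · intro x x' y h h'
    obtain ⟨y₀, h1, h2⟩ := w.edge_cond x
    obtain rfl := Option.some.inj (h1.symm.trans h)
    obtain ⟨z, hz, hz'⟩ := edgeMap_comp_eq_some.1 h'
    exact w.p_inj.2 _ _ _ (h2 z hz') hz

theorem ncard_preimage_le {X Y : Type*} [Finite Y] {f : X → Y} (hf : Function.Injective f)
    (K : Set Y) : (f ⁻¹' K).ncard ≤ K.ncard := by
  rw [← Set.ncard_image_of_injective _ hf]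
  exact Set.ncard_le_ncard (Set.image_preimage_subset f K)

theorem ncard_preimage_lt {X Y : Type*} [Finite Y] {f : X → Y} (hf : Function.Injective f)
    {K : Set Y} {y : Y} (hy : y ∈ K) (hy' : ∀ x, f x ≠ y) : (f ⁻¹' K).ncard < K.ncard := by
  rw [← Set.ncard_image_of_injective _ hf]
  refine Set.ncard_lt_ncard ((Set.ssubset_iff_of_subset (Set.image_preimage_subset f K)).2
    ⟨y, hy, ?_⟩)
  rintro ⟨x, -, hx⟩
  exact hy' x hx

/-- Every instantiation has a part that covers prescribed nodes and edges of the right-hand side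
and whose length is at most the number of these nodes and edges. -/
theorem UQRule.exists_short_inst (ρ : UQRule.{u} Λ ar) {n : ℕ} {ι : InstPair ρ.L}
    (h : ρ.IsInst n ι) : ∀ (KV : Set ι.Rbar.V) (KE : Set ι.Rbar.E),
    ∃ (n₀ : ℕ) (ι₀ : InstPair ρ.L) (a : ι₀.Lbar ⟶ ι.Lbar) (b : ι₀.Rbar ⟶ ι.Rbar),
      ρ.IsInst n₀ ι₀ ∧ n₀ ≤ KV.ncard + KE.ncard ∧ IsTotal a ∧ IsInj a ∧ IsTotal b ∧ IsInj b ∧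
      ι₀.π ≫ a = ι.π ∧ a ≫ ι.γ = ι₀.γ ≫ b ∧
      (∀ y ∈ KV, ∃ x, nodeMap b x = some y) ∧ (∀ y ∈ KE, ∃ x, edgeMap b x = some y) ∧
      (∀ x y r, nodeMap ι.γ x = some y → nodeMap b r = some y → ∃ z, nodeMap a z = some x) := by
  induction h with
  | base =>
    intro KV KE
    exact ⟨0, _, 𝟙 _, 𝟙 _, .base, Nat.zero_le _, isTotal_id _, isInj_id _, isTotal_id _,
      isInj_id _, Category.comp_id _, (Category.id_comp _).trans (Category.comp_id _).symm,
      fun y _ => ⟨y, rfl⟩, fun y _ => ⟨y, rfl⟩, fun x _ _ _ _ => ⟨x, rfl⟩⟩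
  | @step n ι ι' w hι hw hext ih =>
    intro KV KE
    obtain ⟨p', π', p'', π'', hL, hR, hπ, hγ, hγ'⟩ := hext
    have gL := isGluing_of_isPushout hL w.p_total w.p_inj
    have gR := isGluing_of_isPushout hR w.isTotal_comp w.isInj_comp
    choose fV hfV using gR.isTotal.1
    choose fE hfE using gR.isTotal.2
    have iV : Function.Injective fV := fun x y hxy =>
      gR.isInj.1 _ _ _ (hfV x) (by rw [hfV, hxy])
    have iE : Function.Injective fE := fun x y hxy =>
      gR.isInj.2 _ _ _ (hfE x) (by rw [hfE, hxy])
    obtain ⟨n₀, ι₀, a, b, hι₀, hn₀, hat, hai, hbt, hbi, hπ₀, hγ₀, hV, hE, hcov⟩ :=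
      ih (fV ⁻¹' KV) (fE ⁻¹' KE)
    have lV := ncard_preimage_le iV KV
    have lE := ncard_preimage_le iE KE
    -- The last extension is needed only if some prescribed element lies outside the previous
    -- right-hand side.
    by_cases hK : (∀ y ∈ KV, ∃ x, fV x = y) ∧ ∀ y ∈ KE, ∃ x, fE x = y
    · refine ⟨n₀, ι₀, a ≫ p', b ≫ p'', hι₀, by omega, hat.comp gL.isTotal, hai.comp gL.isInj,
        hbt.comp gR.isTotal, hbi.comp gR.isInj, ?_, ?_, fun y hy => ?_, fun y hy => ?_,
        fun x y r hx hr => ?_⟩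
      · rw [← Category.assoc, hπ₀, hπ]
      · rw [Category.assoc, hγ, ← Category.assoc, hγ₀, Category.assoc]
      · obtain ⟨x, rfl⟩ := hK.1 y hy
        obtain ⟨z, hz⟩ := hV x hy
        exact ⟨z, nodeMap_comp_eq_some.2 ⟨x, hz, hfV x⟩⟩
      · obtain ⟨x, rfl⟩ := hK.2 y hy
        obtain ⟨z, hz⟩ := hE x hy
        exact ⟨z, edgeMap_comp_eq_some.2 ⟨x, hz, hfE x⟩⟩
      · obtain ⟨s, hs, hs'⟩ := nodeMap_comp_eq_some.1 hr
        rcases gL.node.cover x with ⟨c, hc⟩ | ⟨c, hc, hc'⟩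
        · have h1 : nodeMap (ι.γ ≫ p'') c = some y := by
            rw [← hγ]
            exact nodeMap_comp_eq_some.2 ⟨x, hc, hx⟩
          obtain ⟨t, ht, ht'⟩ := nodeMap_comp_eq_some.1 h1
          obtain rfl := gR.isInj.1 _ _ _ hs' ht'
          obtain ⟨z, hz⟩ := hcov c _ _ ht hs
          exact ⟨z, nodeMap_comp_eq_some.2 ⟨c, hz, hc⟩⟩
        -- A new left-hand node cannot map into the old right-hand side: its image under `q` would
        -- be that of some `p l`, whose only `q`-preimage is `p l` itself.
        · have h1 : nodeMap (w.q ≫ π'') c = some y := by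
            rw [← hγ']
            exact nodeMap_comp_eq_some.2 ⟨x, hc', hx⟩
          obtain ⟨t, ht, ht'⟩ := nodeMap_comp_eq_some.1 h1
          obtain ⟨l, hl, -⟩ := gR.node.exists_preimage ht' hs'
          obtain ⟨y₀, h2, h3⟩ := w.node_cond l
          obtain rfl := Option.some.inj (h2.symm.trans hl)
          exact absurd (h3 c ht) (hc l)
    -- A prescribed element outside the old right-hand side is lost in the preimage and pays for the
    -- extra step.
    · have hlt : n₀ + 1 ≤ KV.ncard + KE.ncard := by
        rw [not_and_or] at hK
        push Not at hK
        rcases hK with ⟨y, hy, hy'⟩ | ⟨y, hy, hy'⟩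
        · have := ncard_preimage_lt iV hy hy'
          omega
        · have := ncard_preimage_lt iE hy hy'
          omega
      obtain ⟨L₁, p₁, π₁, hL₁⟩ := exists_isPushout ι₀.π w.p_total w.p_inj
      obtain ⟨R₁, q₁, κ₁, hR₁⟩ := exists_isPushout (ι₀.π ≫ ι₀.γ) w.isTotal_comp w.isInj_comp
      have wγ : ι₀.π ≫ ι₀.γ ≫ q₁ = w.p ≫ w.q ≫ κ₁ := by simpa using hR₁.w
      have hπγ : ι.π ≫ ι.γ = (ι₀.π ≫ ι₀.γ) ≫ b := by
        rw [← hπ₀, Category.assoc, hγ₀, Category.assoc]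
      have wa : ι₀.π ≫ a ≫ p' = w.p ≫ π' := by rw [← Category.assoc, hπ₀, hL.w]
      have wb : (ι₀.π ≫ ι₀.γ) ≫ b ≫ p'' = (w.p ≫ w.q) ≫ π'' := by
        rw [← Category.assoc, ← hπγ, hR.w]
      let a' := hL₁.desc (a ≫ p') π' wa
      let b' := hR₁.desc (b ≫ p'') π'' wb
      let γ₁ := hL₁.desc (ι₀.γ ≫ q₁) (w.q ≫ κ₁) wγ
      have ha1 : p₁ ≫ a' = a ≫ p' := hL₁.inl_desc _ _ _
      have ha2 : π₁ ≫ a' = π' := hL₁.inr_desc _ _ _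
      have hb1 : q₁ ≫ b' = b ≫ p'' := hR₁.inl_desc _ _ _
      have hb2 : κ₁ ≫ b' = π'' := hR₁.inr_desc _ _ _
      have hg1 : p₁ ≫ γ₁ = ι₀.γ ≫ q₁ := hL₁.inl_desc _ _ _
      have hg2 : π₁ ≫ γ₁ = w.q ≫ κ₁ := hL₁.inr_desc _ _ _
      -- Extend the short instantiation by the same `w`. By pushout cancellation `a'` and `b'` are
      -- pushouts of `a` and `b`, hence total and injective.
      have poL : IsPushout a p₁ p' a' :=
        IsPushout.of_left (by rw [hπ₀, ha2]; exact hL) ha1.symm hL₁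
      have poR : IsPushout b q₁ p'' b' :=
        IsPushout.of_left (by rw [← hπγ, hb2]; exact hR) hb1.symm hR₁
      have ga := isGluing_of_isPushout poL.flip hat hai
      have gb := isGluing_of_isPushout poR.flip hbt hbi
      refine ⟨n₀ + 1, ⟨L₁, R₁, ι₀.π ≫ p₁, γ₁⟩, a', b',
        .step hι₀ hw ⟨p₁, π₁, q₁, κ₁, hL₁, hR₁, rfl, hg1, hg2⟩, hlt, ga.isTotal, ga.isInj,
        gb.isTotal, gb.isInj, ?_, ?_, fun y hy => ?_, fun y hy => ?_, fun x y r hx hr => ?_⟩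
      · rw [Category.assoc, ha1, ← Category.assoc, hπ₀, hπ]
      · refine hL₁.hom_ext ?_ ?_
        · rw [← Category.assoc, ha1, Category.assoc, hγ, ← Category.assoc, hγ₀, Category.assoc,
            ← Category.assoc p₁, hg1, Category.assoc, hb1]
        · rw [← Category.assoc, ha2, hγ', ← Category.assoc, hg2, Category.assoc, hb2]
      · rcases gR.node.cover y with ⟨c, hc⟩ | ⟨c, -, hc⟩
        · obtain rfl := Option.some.inj ((hfV c).symm.trans hc)
          obtain ⟨x, hx⟩ := hV c hy
          have h1 : nodeMap (q₁ ≫ b') x = some (fV c) := by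
            rw [hb1]
            exact nodeMap_comp_eq_some.2 ⟨c, hx, hc⟩
          obtain ⟨z, -, hz⟩ := nodeMap_comp_eq_some.1 h1
          exact ⟨z, hz⟩
        · rw [← hb2] at hc
          obtain ⟨z, -, hz⟩ := nodeMap_comp_eq_some.1 hc
          exact ⟨z, hz⟩
      · rcases gR.edge.cover y with ⟨c, hc⟩ | ⟨c, -, hc⟩
        · obtain rfl := Option.some.inj ((hfE c).symm.trans hc)
          obtain ⟨x, hx⟩ := hE c hy
          have h1 : edgeMap (q₁ ≫ b') x = some (fE c) := by
            rw [hb1]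
            exact edgeMap_comp_eq_some.2 ⟨c, hx, hc⟩
          obtain ⟨z, -, hz⟩ := edgeMap_comp_eq_some.1 h1
          exact ⟨z, hz⟩
        · rw [← hb2] at hc
          obtain ⟨z, -, hz⟩ := edgeMap_comp_eq_some.1 hc
          exact ⟨z, hz⟩
      · rcases gL.node.cover x with ⟨c, hc⟩ | ⟨c, -, hc⟩
        · have h1 : nodeMap (ι.γ ≫ p'') c = some y := by
            rw [← hγ]
            exact nodeMap_comp_eq_some.2 ⟨x, hc, hx⟩
          obtain ⟨t, ht, ht'⟩ := nodeMap_comp_eq_some.1 h1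
          -- The value `y` lies both in the old right-hand side and in the range of `b'`, so it
          -- comes from `ι₀.Rbar` and the induction hypothesis applies.
          obtain ⟨s, hs, -⟩ := gb.node.exists_preimage ht' hr
          obtain ⟨z, hz⟩ := hcov c t s ht hs
          have h2 : nodeMap (p₁ ≫ a') z = some x := by
            rw [ha1]
            exact nodeMap_comp_eq_some.2 ⟨c, hz, hc⟩
          obtain ⟨z', -, hz'⟩ := nodeMap_comp_eq_some.1 h2
          exact ⟨z', hz'⟩
        · rw [← ha2] at hc
          obtain ⟨z, -, hz⟩ := nodeMap_comp_eq_some.1 hc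
          exact ⟨z, hz⟩

end Instantiations

/-! ### The instantiation bound and the backward step -/

theorem ncard_dom_le {X Y : Type*} [Finite Y] {k : X → Option Y}
    (hk : ∀ x x' y, k x = some y → k x' = some y → x = x') :
    {x | ∃ y, k x = some y}.ncard ≤ Nat.card Y := by
  rw [← Nat.card_coe_set_eq]
  refine Nat.card_le_card_of_injective (fun x => x.2.choose) fun x x' h => Subtype.ext ?_
  refine hk _ _ _ x.2.choose_spec ?_
  rw [x'.2.choose_spec]
  exact congrArg some h.symm

/-- The application condition is inherited by submatches that contain all edges of the match that
lie in the subgraph. -/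
theorem UQRule.AppCond.of_sub {ρ : UQRule.{u} Λ ar} {ι ι₀ : InstPair ρ.L} {G' G₀ : HGraph.{u} Λ ar}
    {m : ι.Lbar ⟶ G'} (h : ρ.AppCond ι m) {m₀ : ι₀.Lbar ⟶ G₀} {a : ι₀.Lbar ⟶ ι.Lbar} {j : G₀ ⟶ G'}
    (jt : IsTotal j) (ha : ι₀.π ≫ a = ι.π) (hj : m₀ ≫ j = a ≫ m)
    (hE : ∀ e e' d, edgeMap j e = some e' → edgeMap m d = some e' →
      ∃ d', edgeMap m₀ d' = some e) : ρ.AppCond ι₀ m₀ := by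
  intro x hx y hy e he
  obtain ⟨e', he'⟩ := jt.2 e
  obtain ⟨y', hy', hinc⟩ := he.map he'
  have h1 : nodeMap (ι.π ≫ m) x = some y' := by
    rw [← ha, Category.assoc, ← hj, ← Category.assoc]
    exact nodeMap_comp_eq_some.2 ⟨y, hy, hy'⟩
  obtain ⟨d, hd⟩ := h x hx y' h1 e' hinc
  exact hE e e' d he' hd

/-- The size of `G` bounds the length of the instantiations needed for a backward step from `G`. -/
theorem UQRule.isInstBound_size (ρ : UQRule.{u} Λ ar) (k : ℕ) (G : HGraph.{u} Λ ar) :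
    ρ.IsInstBound k G G.size := by
  rintro n ι hι G' ⟨R', μ, m', m, hμ, mt', mi', hG', mt, mi, ⟨φ', hpo⟩, -, happ⟩
  -- The elements to cover are those visible in `G`. Since `μ ≫ m'` is injective, the size of `G`
  -- bounds their number.
  obtain ⟨n₀, ι₀, a, b, hι₀, hn₀, hat, hai, hbt, hbi, hπ, hγ, hV, hE, hcov⟩ :=
    ρ.exists_short_inst hι {y | ∃ z, nodeMap (μ ≫ m') y = some z}
      {y | ∃ z, edgeMap (μ ≫ m') y = some z}
  have hμm := hμ.1.comp mi'
  have hb1 := ncard_dom_le hμm.1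
  have hb2 := ncard_dom_le hμm.2
  have hg := isGluing_of_isPushout hpo mt mi
  obtain ⟨G₀, m₀, ψ, j, m₀t, m₀i, hg₀, jt, ji, hj, hsub, hoff, hedge⟩ :=
    exists_sub_complement (φ₀ := ι₀.γ ≫ b ≫ μ) hg mt mi (σ := 𝟙 G)
      ⟨isInj_id G, isSurj_id G⟩ hat hai mt' mi'
      (by rw [Category.comp_id, ← Category.assoc a, ← Category.assoc a, hγ]; simp)
      (fun y z hz => by
        rw [Category.comp_id, Category.assoc] at hz
        obtain ⟨s, hs, hs'⟩ := nodeMap_comp_eq_some.1 hz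
        obtain ⟨r, hr⟩ := hV s ⟨z, hs'⟩
        exact hcov y s r hs hr)
      (fun z => by rw [Category.comp_id]) (fun z => by rw [Category.comp_id])
  refine ⟨G₀, ⟨n₀, ι₀, ?_, hι₀, R', b ≫ μ, m', m₀, ⟨hbi.comp hμ.1, ?_, ?_⟩, mt', mi',
    mem_boundedPath_of_isInj j jt ji hG', m₀t, m₀i, ⟨ψ, hg₀.isPushout⟩,
    fun H hH => hg₀.subOrder_of_complement hoff hH, happ.of_sub jt hπ hj hedge⟩, hsub⟩
  · exact hn₀.trans (Nat.add_le_add hb1 hb2)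
  -- `b ≫ μ` is still onto `R'`, because `m'` is total and `b` covers the domain of `μ ≫ m'`.
  · intro z
    obtain ⟨s, hs⟩ := hμ.2.1 z
    obtain ⟨t, ht⟩ := mt'.1 z
    obtain ⟨r, hr⟩ := hV s ⟨t, nodeMap_comp_eq_some.2 ⟨z, hs, ht⟩⟩
    exact ⟨r, nodeMap_comp_eq_some.2 ⟨s, hr, hs⟩⟩
  · intro z
    obtain ⟨s, hs⟩ := hμ.2.2 z
    obtain ⟨t, ht⟩ := mt'.2 z
    obtain ⟨r, hr⟩ := hE s ⟨t, edgeMap_comp_eq_some.2 ⟨z, hs, ht⟩⟩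
    exact ⟨r, edgeMap_comp_eq_some.2 ⟨s, hr, hs⟩⟩

/-- Backward steps from `G` reach a subgraph of each graph of bounded path length that can be
rewritten to a graph above `G`. -/
theorem UQRule.exists_backInst_of_rewrites {ρ : UQRule.{u} Λ ar} {k : ℕ} {G G' H : HGraph.{u} Λ ar}
    (hGH : SubOrder G H) (hG' : G' ∈ boundedPath k) (h : ρ.Rewrites G' H) :
    ∃ (n : ℕ) (ι : InstPair ρ.L), ρ.IsInst n ι ∧ ∃ G₀ ∈ ρ.backInst k ι G, SubOrder G₀ G' := by
  obtain ⟨σ, hσ⟩ := hGH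
  obtain ⟨n, ι, m, hι, mt, mi, happ, φ', n', hpo⟩ := h
  have hg := isGluing_of_isPushout hpo.flip mt mi
  -- `R'` is the domain of `n' ≫ σ`, which makes the co-match into `G` total.
  let P : Set ι.Rbar.V := {x | ∃ y, nodeMap (n' ≫ σ) x = some y}
  let Q : Set ι.Rbar.E := {x | ∃ y, edgeMap (n' ≫ σ) x = some y}
  have hPQ : ∀ e ∈ Q, ∀ x ∈ ι.Rbar.c e, x ∈ P := by
    rintro e ⟨e', he'⟩ x hx
    obtain ⟨y, hy, -⟩ := Incident.map he' hx
    exact ⟨y, hy⟩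
  let μ := ι.Rbar.restrictRes P Q hPQ
  let m' : ι.Rbar.restrict P Q hPQ ⟶ G := ι.Rbar.restrictIncl P Q hPQ ≫ n' ≫ σ
  have mt' : IsTotal m' := ⟨fun x => x.2, fun x => x.2⟩
  have mi' : IsInj m' := isInj_restrictIncl.comp (hg.isInj.comp hσ.1)
  have hμm : μ ≫ m' = n' ≫ σ :=
    restrictRes_comp_restrictIncl_comp _ (fun x y h => ⟨y, h⟩) (fun x y h => ⟨y, h⟩)
  obtain ⟨G₀, m₀, ψ, j, m₀t, m₀i, hg₀, jt, ji, hj, hsub, hoff, hedge⟩ :=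
    exists_sub_complement (φ₀ := ι.γ ≫ μ) hg mt mi hσ (isTotal_id _) (isInj_id _) mt' mi'
      (by rw [Category.id_comp, Category.assoc, hμm]) (fun y _ _ => ⟨y, rfl⟩)
      (fun z => ⟨fun ⟨r, hr⟩ => ⟨r.1, hr⟩, fun ⟨r, hr⟩ => ⟨⟨r, z, hr⟩, hr⟩⟩)
      (fun z => ⟨fun ⟨r, hr⟩ => ⟨r.1, hr⟩, fun ⟨r, hr⟩ => ⟨⟨r, z, hr⟩, hr⟩⟩)
  exact ⟨n, ι, hι, G₀, ⟨_, μ, m', m₀, isSubgraphMor_restrictRes, mt', mi',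
    mem_boundedPath_of_isInj j jt ji hG', m₀t, m₀i, ⟨ψ, hg₀.isPushout⟩,
    fun H hH => hg₀.subOrder_of_complement hoff hH,
    happ.of_sub jt (Category.comp_id _) hj hedge⟩, hsub⟩

end HGraph

theorem mainTheorem5 {Λ : Type v} [Finite Λ] {ar : Λ → ℕ} (𝓡 : HGraph.UGTS.{u} Λ ar) (k : ℕ)
    (G : HGraph.{u} Λ ar) :
    (∀ ρ ∈ 𝓡.rules, ρ.IsInstBound k G G.size) ∧
    ∀ I : HGraph.UQRule.{u} Λ ar → HGraph.{u} Λ ar → ℕ,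
      (∀ ρ ∈ 𝓡.rules, ρ.IsInstBound k G (I ρ G)) →
      HGraph.upClosure (𝓡.predIn (HGraph.boundedPath k) (HGraph.upClosure {G})) ⊆
        HGraph.upClosure (𝓡.predBasis k I G) := by
  refine ⟨fun ρ _ => ρ.isInstBound_size k G, fun I hI X hX => ?_⟩
  obtain ⟨G', ⟨⟨H, ⟨_, rfl, hGH⟩, ρ, hρ, hrew⟩, hG'⟩, hX⟩ := hX
  obtain ⟨n, ι, hι, G₀, hG₀, hsub⟩ := HGraph.UQRule.exists_backInst_of_rewrites hGH hG' hrew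
  obtain ⟨G₁, hG₁, hsub'⟩ := hI ρ hρ n ι hι G₀ hG₀
  exact ⟨G₁, ⟨ρ, hρ, hG₁⟩, (hsub'.trans hsub).trans hX⟩
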